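/- **Setting.** Let $H,K$ be real Hilbert spaces, $T\colon H\to K$ a Hilbert–Schmidt operator ($\operatorname{tr}(T^*T)<\infty$), and $\xi$ a Gaussian white noise on $K$, i.e. an a.s. linear family $(\langle\xi,g\rangle)_{g\in K}$ of random variables with $\langle\xi,g\rangle\sim\mathcal N(0,\|g\|^2)$. For $f\in H$ and $\sigma>0$ we observe $Y=Tf+\sigma\xi$, i.e. $\langle Y,g\rangle=\langle Tf,g\rangle+\sigma\langle\xi,g\rangle$ for $g\in K$; write $P_f$ for the corresponding probability. Put $a:=\|T^*T\|$. * *Regularization.* $(g_\tau)_{0<\tau\le a}$ is a family of real functions on $[0,a]$ which, with $r_\tau(t):=1-t\,g_\tau(t)$, satisfies: $|r_\tau(t)|\to0$ as $\tau\to0$ for each $0<t\le a$; $\sup_{0\le t\le a}|r_\tau(t)|\le\gamma_1$; and $\sup_{0\le t\le a}\tau|g_\tau(t)|\le\gamma_*$ for all $0<\tau\le a$, with some $\gamma_*\ge1$. Put $R_\tau:=g_\tau(T^*T)T^*$. * *Smoothness.* $\varphi$ is continuous and non-decreasing on $[0,a]$ with $\varphi(0)=0$, and $\mathcal E_\varphi:=\{\varphi(T^*T)\omega:\|\omega\|\le1\}$.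 The regularization has qualification $\varphi$ with constant $\gamma$: $|r_\tau(t)|\varphi(t)\le\gamma\varphi(\tau)$ for $0\le t\le a$, $0<\tau\le a$. * *Effective dimension.* $\mathcal N(\tau):=\operatorname{tr}\big((T^*T+\tau I)^{-1}T^*T\big)$. * *Tests.* $\Phi_{\alpha,\tau}=\mathbf 1\{\|R_\tau Y\|^2-S_\tau^2>t_{\tau,\alpha}\}$, where $S_\tau^2=\sigma^2\operatorname{tr}(R_\tau^*R_\tau)$ and $t_{\tau,\alpha}$ is the $(1-\alpha)$-quantile of $\|R_\tau Y\|^2-S_\tau^2$ under $f=0$. For $0<q<1$ and $M\in\mathbb N$ the adaptive test is $$\Phi^\star_\alpha=\max_{0\le j\le M-1}\Phi_{\alpha/M,\;q^ja}.$$ * *Separation radius.* $\rho(\Phi,\beta,\mathcal E)=\inf\{\rho\ge0:\ \sup_{f\in\mathcal E,\,\|f\|>\rho}P_f(\Phi=0)\le\beta\}$. **Theorem.** Let $\alpha,\beta,q\in(0,1)$ and constants $\gamma_1,\gamma_*,\gamma,A$ be given. There are constants $C,D>0$, depending only on $\alpha,\beta,q,\gamma_1,\gamma_*,\gamma,A$,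 such that the following holds in every setting as above. Suppose that, for all sufficiently small $\sigma>0$, the size $M=M(\sigma)$ of the grid satisfies $$M\ \ge\ \log_{1/q}\!\big(\sqrt2\,\|T^*T\|\big)+\log_{1/q}\!\big(1/\sigma^2\big),\qquad \log M\ \le\ A\,\log\log_{1/q}(1/\sigma^2),$$ that $\varphi(\tau_{\min})\le1$ with $\tau_{\min}=q^{M-1}\|T^*T\|$, and that $\tau_*=\tau_*(\sigma)\in(0,\|T^*T\|]$ solves $$\varphi^2(\tau_*)=\sigma^2\sqrt{\log\log_{1/q}(1/\sigma^2)}\;\frac{\sqrt{\mathcal N(\tau_*)}}{\tau_*}.$$ Suppose further that $$\frac{\log\log(1/\sigma^2)}{\mathcal N(\tau_*)}\to0\qquad\text{as }\sigma\to0 .$$ Then, for all sufficiently small $\sigma>0$, $$\rho^2(\Phi^\star_\alpha,\beta,\mathcal E_\varphi)\ \le\ C\inf_{0<\tau\le\|T^*T\|}\Big(\sigma^2\sqrt{\log\log_{1/q}(1/\sigma^2)}\;\frac{\sqrt{\mathcal N(\tau)}}{\tau}+\varphi^2(\tau)\Big).$$ In particular, $\tau_*\searrow0$ as $\sigma\searrow0$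 (that is, $\tau_*\to0$ from above), and $\rho(\Phi^\star_\alpha,\beta,\mathcal E_\varphi)\le D\,\varphi(\tau_*)$ for all sufficiently small $\sigma>0$. -/

import Mathlib

open MeasureTheory ProbabilityTheory Filter Set
open scoped Topology ENNReal NNReal

universe u v w

noncomputable section

namespace SignalDetection

/-! ### Operators: trace, functional calculus, effective dimension -/

/-- The trace `∑ᵢ ⟪B eᵢ, eᵢ⟫ ∈ [0,∞]` of a positive operator `B`, computed in a Hilbert basis
`(eᵢ)` of `E` (for positive `B` the value does not depend on the basis). -/
def opTrace {E : Type*} [NormedAddCommGroup E] [InnerProductSpace ℝ E] [CompleteSpace E]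
    (B : E →L[ℝ] E) : ℝ≥0∞ :=
  ∑' i : (exists_hilbertBasis ℝ E).choose,
    ENNReal.ofReal (inner ℝ (B ((exists_hilbertBasis ℝ E).choose_spec.choose i))
      ((exists_hilbertBasis ℝ E).choose_spec.choose i))

/-- The operator `T* T`. -/
def normalOp {H K : Type*} [NormedAddCommGroup H] [InnerProductSpace ℝ H] [CompleteSpace H]
    [NormedAddCommGroup K] [InnerProductSpace ℝ K] [CompleteSpace K]
    (T : H →L[ℝ] K) : H →L[ℝ] H :=
  (ContinuousLinearMap.adjoint T).comp T

/-- `T` is a Hilbert-Schmidt operator: `tr (T* T) < ∞`. -/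
def IsHilbertSchmidt {H K : Type*} [NormedAddCommGroup H] [InnerProductSpace ℝ H]
    [CompleteSpace H] [NormedAddCommGroup K] [InnerProductSpace ℝ K] [CompleteSpace K]
    (T : H →L[ℝ] K) : Prop :=
  opTrace (normalOp T) < ∞

open Classical in
/-- The operator function `g(A)` of a compact self-adjoint operator `A`: the bounded operator
which acts as multiplication by `g(t)` on the eigenspace of `A` for every eigenvalue `t`.
As the eigenvectors of `A` span a dense subspace, there is at most one such operator; it exists
whenever `g` is bounded on the set of eigenvalues of `A`, continuous or not. -/
def opFun {H : Type*} [NormedAddCommGroup H] [InnerProductSpace ℝ H]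
    (g : ℝ → ℝ) (A : H →L[ℝ] H) : H →L[ℝ] H :=
  if h : ∃ B : H →L[ℝ] H, ∀ (t : ℝ) (x : H), A x = t • x → B x = g t • x then h.choose else 0

/-- The effective dimension `N(τ) = tr ((A + τ I)⁻¹ A)`. -/
def effDim {H : Type*} [NormedAddCommGroup H] [InnerProductSpace ℝ H] [CompleteSpace H]
    (A : H →L[ℝ] H) (τ : ℝ) : ℝ :=
  (opTrace (Ring.inverse (A + τ • (1 : H →L[ℝ] H)) * A)).toReal

/-! ### Regularization schemes, smoothness -/

/-- The family `(g_τ)`, `0 < τ ≤ a` (with `a = ‖T* T‖`), of functions on `[0, a]` is a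
regularization with constants `γ₁` and `γs ≥ 1`; `r_τ(t) = 1 - t g_τ(t)` is the residual function.
No regularity of `g_τ(t)` in `τ` is required. -/
structure IsRegularization (a : ℝ) (g : ℝ → ℝ → ℝ) (γ₁ γs : ℝ) : Prop where
  tendsto_zero : ∀ t ∈ Ioc 0 a, Tendsto (fun τ => |1 - t * g τ t|) (𝓝[>] 0) (𝓝 0)
  residual_le : ∀ τ ∈ Ioc 0 a, ∀ t ∈ Icc 0 a, |1 - t * g τ t| ≤ γ₁
  one_le : 1 ≤ γs
  mul_abs_le : ∀ τ ∈ Ioc 0 a, ∀ t ∈ Icc 0 a, τ * |g τ t| ≤ γs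

/-- `φ` is an index function on `[0, a]`: continuous, non-decreasing, `φ(0) = 0`. -/
structure IsIndexFunction (a : ℝ) (φ : ℝ → ℝ) : Prop where
  continuousOn : ContinuousOn φ (Icc 0 a)
  monotoneOn : MonotoneOn φ (Icc 0 a)
  map_zero : φ 0 = 0

/-- The regularization `g` has qualification `φ` with constant `γ`. -/
def HasQualification (a : ℝ) (g : ℝ → ℝ → ℝ) (φ : ℝ → ℝ) (γ : ℝ) : Prop :=
  ∀ τ ∈ Ioc 0 a, ∀ t ∈ Icc 0 a, |1 - t * g τ t| * φ t ≤ γ * φ τ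

/-- The source set `E_φ = {φ(T* T) w : ‖w‖ ≤ 1}`. -/
def sourceSet {H K : Type*} [NormedAddCommGroup H] [InnerProductSpace ℝ H] [CompleteSpace H]
    [NormedAddCommGroup K] [InnerProductSpace ℝ K] [CompleteSpace K]
    (T : H →L[ℝ] K) (φ : ℝ → ℝ) : Set H :=
  {f | ∃ w : H, ‖w‖ ≤ 1 ∧ f = opFun φ (normalOp T) w}

/-- The reconstruction operator `R_τ = g_τ(T* T) T*`. -/
def reconOp {H K : Type*} [NormedAddCommGroup H] [InnerProductSpace ℝ H] [CompleteSpace H]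
    [NormedAddCommGroup K] [InnerProductSpace ℝ K] [CompleteSpace K]
    (T : H →L[ℝ] K) (g : ℝ → ℝ → ℝ) (τ : ℝ) : K →L[ℝ] H :=
  (opFun (g τ) (normalOp T)).comp (ContinuousLinearMap.adjoint T)

/-! ### The statistical model -/

/-- Gaussian white noise on `K`: a weak random element (an almost surely linear family
`ξ g = ⟪ξ, g⟫`, `g ∈ K`, of real random variables) with `⟪ξ, g⟫ ∼ N(0, ‖g‖²)` for all `g`. -/
structure IsGaussianWhiteNoise {Ω K : Type*} [MeasurableSpace Ω]
    [NormedAddCommGroup K] [InnerProductSpace ℝ K]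
    (P : Measure Ω) (ξ : K → Ω → ℝ) : Prop where
  ae_add : ∀ g₁ g₂ : K, ξ (g₁ + g₂) =ᵐ[P] ξ g₁ + ξ g₂
  ae_smul : ∀ (c : ℝ) (g : K), ξ (c • g) =ᵐ[P] c • ξ g
  hasLaw : ∀ g : K, HasLaw (ξ g) (gaussianReal 0 (‖g‖₊ ^ 2)) P

/-- The observation `Y = T f + σ ξ`, that is, the family
`⟪Y, g⟫ = ⟪T f, g⟫ + σ ⟪ξ, g⟫`, `g ∈ K`. -/
def obs {Ω H K : Type*} [NormedAddCommGroup H] [InnerProductSpace ℝ H]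
    [NormedAddCommGroup K] [InnerProductSpace ℝ K]
    (T : H →L[ℝ] K) (ξ : K → Ω → ℝ) (σ : ℝ) (f : H) : K → Ω → ℝ :=
  fun g ω => inner ℝ (T f) g + σ * ξ g ω

open Classical in
/-- The random element `R Y` of `H`, for weak data `Y` on `K` and a Hilbert-Schmidt operator
`R : K → H`: the (almost surely unique) strongly measurable `H`-valued random element with
`⟪R Y, w⟫ = ⟪Y, R* w⟫` almost surely, for every `w ∈ H`. -/
def applyToData {Ω H K : Type*} [MeasurableSpace Ω]
    [NormedAddCommGroup H] [InnerProductSpace ℝ H] [CompleteSpace H]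
    [NormedAddCommGroup K] [InnerProductSpace ℝ K] [CompleteSpace K]
    (P : Measure Ω) (R : K →L[ℝ] H) (Y : K → Ω → ℝ) : Ω → H :=
  if h : ∃ Z : Ω → H, AEStronglyMeasurable Z P ∧
      ∀ w : H, (fun ω => inner ℝ (Z ω) w) =ᵐ[P] Y (ContinuousLinearMap.adjoint R w)
    then h.choose else 0

/-! ### Tests -/

/-- The `p`-quantile of a probability distribution `ν` on `ℝ`. -/
def quantile (ν : Measure ℝ) (p : ℝ) : ℝ := sInf {t : ℝ | p ≤ cdf ν t}

/-- The variance `S_R² = σ² tr (R* R)`. -/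
def varSq {H K : Type*} [NormedAddCommGroup H] [InnerProductSpace ℝ H] [CompleteSpace H]
    [NormedAddCommGroup K] [InnerProductSpace ℝ K] [CompleteSpace K]
    (σ : ℝ) (R : K →L[ℝ] H) : ℝ :=
  σ ^ 2 * (opTrace (normalOp R)).toReal

/-- The statistic `‖R Y‖² - S_R²`. -/
def stat {Ω H K : Type*} [MeasurableSpace Ω]
    [NormedAddCommGroup H] [InnerProductSpace ℝ H] [CompleteSpace H]
    [NormedAddCommGroup K] [InnerProductSpace ℝ K] [CompleteSpace K]
    (P : Measure Ω) (σ : ℝ) (R : K →L[ℝ] H) (Y : K → Ω → ℝ) : Ω → ℝ :=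
  fun ω => ‖applyToData P R Y ω‖ ^ 2 - varSq σ R

/-- The threshold `t_{R,α}`: the `(1 - α)`-quantile of `‖R Y‖² - S_R²` under `f = 0`. -/
def threshold {Ω H K : Type*} [MeasurableSpace Ω]
    [NormedAddCommGroup H] [InnerProductSpace ℝ H] [CompleteSpace H]
    [NormedAddCommGroup K] [InnerProductSpace ℝ K] [CompleteSpace K]
    (P : Measure Ω) (T : H →L[ℝ] K) (ξ : K → Ω → ℝ) (σ α : ℝ) (R : K →L[ℝ] H) : ℝ :=
  quantile (P.map (stat P σ R (obs T ξ σ 0))) (1 - α)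

open Classical in
/-- The test `Φ_{α,R}`: reject (value `1`) iff `‖R Y‖² - S_R² > t_{R,α}`. -/
def test {Ω H K : Type*} [MeasurableSpace Ω]
    [NormedAddCommGroup H] [InnerProductSpace ℝ H] [CompleteSpace H]
    [NormedAddCommGroup K] [InnerProductSpace ℝ K] [CompleteSpace K]
    (P : Measure Ω) (T : H →L[ℝ] K) (ξ : K → Ω → ℝ) (σ α : ℝ) (R : K →L[ℝ] H)
    (Y : K → Ω → ℝ) : Ω → ℕ :=
  fun ω => if threshold P T ξ σ α R < stat P σ R Y ω then 1 else 0

/-- The adaptive test `Φ*_α`: the maximum of the tests `Φ_{α/M,τ}` over the exponential grid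
`τ = q ^ j * ‖T* T‖`, `j = 0, …, M - 1`. -/
def adaptiveTest {Ω H K : Type*} [MeasurableSpace Ω]
    [NormedAddCommGroup H] [InnerProductSpace ℝ H] [CompleteSpace H]
    [NormedAddCommGroup K] [InnerProductSpace ℝ K] [CompleteSpace K]
    (P : Measure Ω) (T : H →L[ℝ] K) (ξ : K → Ω → ℝ) (g : ℝ → ℝ → ℝ) (q : ℝ) (M : ℕ)
    (σ α : ℝ) (Y : K → Ω → ℝ) : Ω → ℕ :=
  fun ω => (Finset.range M).sup fun j =>
    test P T ξ σ (α / M) (reconOp T g (q ^ j * ‖normalOp T‖)) Y ω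

/-- The separation radius of a test `Φ` (a function of the data) over the class `E`: the infimum
of all `ρ ≥ 0` with `sup {P_f (Φ = 0) : f ∈ E, ‖f‖ > ρ} ≤ β`. -/
def separationRadius {Ω H K : Type*} [MeasurableSpace Ω]
    [NormedAddCommGroup H] [InnerProductSpace ℝ H]
    [NormedAddCommGroup K] [InnerProductSpace ℝ K]
    (P : Measure Ω) (T : H →L[ℝ] K) (ξ : K → Ω → ℝ) (σ : ℝ)
    (Φ : (K → Ω → ℝ) → Ω → ℕ) (β : ℝ) (E : Set H) : ℝ :=
  sInf {ρ : ℝ | 0 ≤ ρ ∧ ∀ f ∈ E, ρ < ‖f‖ → P.real {ω | Φ (obs T ξ σ f) ω = 0} ≤ β}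

/-- `log log_{1/q} (1/σ²)`. -/
def logLog (q σ : ℝ) : ℝ := Real.log (Real.logb (1 / q) (1 / σ ^ 2))

end SignalDetection

end

/-!
The proof rests on four ingredients.

*Diagonalization.* A Hilbert-Schmidt operator is compact, so `T* T` is diagonal in a Hilbert basis
`(uᵢ)` with eigenvalues `sᵢ` (`exists_eigenbasis`). Operator functions act diagonally
(`opFun_apply_of_diagonal`), the effective dimension is `N(τ) = ∑ sᵢ / (sᵢ + τ)` (`hasSum_effDim`),
and `R_τ R_τ*` has the eigenvalues `λᵢ = sᵢ g_τ(sᵢ)²`. The bounds on `t g_τ(t)` and `τ g_τ(t)` give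
`λᵢ ≤ κ / τ` and `∑ λᵢ² ≤ κ² N(τ) / τ²` (`mul_sq_bounds`). The same representation shows that
`N(τ)` decreases and `τ N(τ)` increases in `τ`.

*Noise.* White noise is an isometry into `L²`, which makes orthogonal coordinates independent
Gaussians. The random element `Z = R ξ` is the series `∑ ξ(R* uᵢ) uᵢ` (`exists_random_series`), and
`R Y = R T f + σ Z` almost surely. Exponential moments of squared Gaussians, passed to the limit by
Fatou's lemma, yield `‖Z‖² - tr (R* R) ≲ √x (∑ λᵢ²)^{1/2} + x sup λᵢ` up to probability `e^{-x}`, and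
the same bound from below (`measure_ge_le_exp`).

*One test.* The upper tail bounds the threshold; the lower tail together with Chebyshev's inequality
for the Gaussian cross term bounds the error of the second kind, once `‖R T f‖` dominates the noise
(`measureReal_stat_le_threshold_le`). For `f` in the source set the qualification gives
`‖R T f‖ ≥ ‖f‖ - γ φ(τ)` (`norm_reconOp_sub_le`).

*Adaptation.* Let `L = log log_{1/q} (1/σ²)`. The hypothesis on `N(τ_*)` gives `L ≤ N(τ_*)`, so with
`x ∼ log (M / α) ≲ L` the linear term `x` of the deviation bound is at most a multiple of
`√L √N(τ_*)`, and the noise level at `τ_*` is a multiple of `φ(τ_*)²`. The equation for `τ_*` together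
with `φ(τ_min) ≤ 1` forces `τ_min ≤ τ_*`, whence a grid point lies in `[q τ_*, τ_*]`; the test at
this point alone has the required power (`separationRadius_adaptiveTest_le`). Finally `φ(τ_*)²` is
at most the infimum on the right hand side, because one of its two terms decreases and the other
increases with `τ` (`sq_le_iInf`), and `τ_* N(τ_*) ≤ tr (T* T)` with `N(τ_*) → ∞` gives `τ_* → 0`.
-/

/-! ### Operators that are diagonal in a Hilbert basis -/

namespace HilbertBasis

variable {ι : Type*} {E : Type*} [NormedAddCommGroup E] [InnerProductSpace ℝ E]

theorem hasSum_inner_smul (b : HilbertBasis ι ℝ E) (x : E) :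
    HasSum (fun i => inner ℝ (b i) x • b i) x := by
  simpa only [b.repr_apply_apply] using b.hasSum_repr x

theorem hasSum_inner_sq (b : HilbertBasis ι ℝ E) (x : E) :
    HasSum (fun i => inner ℝ (b i) x ^ 2) (‖x‖ ^ 2) := by
  have h := b.hasSum_inner_mul_inner x x
  rw [real_inner_self_eq_norm_sq] at h
  refine h.congr_fun fun i => ?_
  rw [real_inner_comm, sq]

theorem tsum_ofReal_inner_sq (b : HilbertBasis ι ℝ E) (x : E) :
    ∑' i, ENNReal.ofReal (inner ℝ (b i) x ^ 2) = ENNReal.ofReal (‖x‖ ^ 2) := by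
  rw [← (b.hasSum_inner_sq x).tsum_eq,
    ENNReal.ofReal_tsum_of_nonneg (fun _ => sq_nonneg _) (b.hasSum_inner_sq x).summable]

variable {F : Type*} [NormedAddCommGroup F] [InnerProductSpace ℝ F]

theorem hasSum_inner_smul_map (b : HilbertBasis ι ℝ E) (B : E →L[ℝ] F) (x : E) :
    HasSum (fun i => inner ℝ (b i) x • B (b i)) (B x) := by
  simpa using (b.hasSum_inner_smul x).mapL B

theorem ext_clm (b : HilbertBasis ι ℝ E) {B C : E →L[ℝ] F} (h : ∀ i, B (b i) = C (b i)) :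
    B = C := by
  ext x
  exact (b.hasSum_inner_smul_map B x).unique (by simpa only [h] using b.hasSum_inner_smul_map C x)

theorem inner_apply_of_diagonal (b : HilbertBasis ι ℝ E) {B : E →L[ℝ] E} {d : ι → ℝ}
    (hB : ∀ i, B (b i) = d i • b i) (i : ι) (x : E) :
    inner ℝ (b i) (B x) = d i * inner ℝ (b i) x := by
  classical
  have h := (b.hasSum_inner_smul_map B x).mapL (innerSL ℝ (b i))
  refine h.unique ?_
  refine (hasSum_ite_eq i (d i * inner ℝ (b i) x)).congr_fun fun j => ?_
  rw [innerSL_apply_apply, inner_smul_right, hB, inner_smul_right,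
    orthonormal_iff_ite.1 b.orthonormal]
  by_cases hij : i = j
  · subst hij; simp [mul_comm]
  · simp [hij, Ne.symm hij]

theorem norm_apply_le_of_diagonal (b : HilbertBasis ι ℝ E) {B : E →L[ℝ] E} {d : ι → ℝ} {c : ℝ}
    (hc : 0 ≤ c) (hB : ∀ i, B (b i) = d i • b i) (hd : ∀ i, |d i| ≤ c) (x : E) :
    ‖B x‖ ≤ c * ‖x‖ := by
  have h : ‖B x‖ ^ 2 ≤ (c * ‖x‖) ^ 2 := by
    rw [mul_pow]
    refine hasSum_le (fun i => ?_) (b.hasSum_inner_sq (B x))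
      ((b.hasSum_inner_sq x).mul_left (c ^ 2))
    rw [b.inner_apply_of_diagonal hB, mul_pow]
    exact mul_le_mul_of_nonneg_right
      (sq_le_sq' (by linarith [abs_le.1 (hd i)]) (abs_le.1 (hd i)).2) (sq_nonneg _)
  exact le_of_sq_le_sq h (by positivity)

theorem exists_diagonal (b : HilbertBasis ι ℝ E) {d : ι → ℝ} {c : ℝ} (hd : ∀ i, |d i| ≤ c) :
    ∃ B : E →L[ℝ] E, ∀ i, B (b i) = d i • b i := by
  classical
  have hle (f : lp (fun _ : ι => ℝ) 2) (i : ι) : ‖d i * f i‖ ≤ ‖(c • f) i‖ := by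
    rw [lp.coeFn_smul, Pi.smul_apply, smul_eq_mul, norm_mul, norm_mul]
    gcongr
    exact (hd i).trans (le_abs_self c)
  have hmem (f : lp (fun _ : ι => ℝ) 2) : Memℓp (fun i => d i * f i) 2 :=
    (lp.memℓp (c • f)).mono' (hle f)
  let D : lp (fun _ : ι => ℝ) 2 →L[ℝ] lp (fun _ : ι => ℝ) 2 :=
    LinearMap.mkContinuous
      { toFun := fun f => ⟨fun i => d i * f i, hmem f⟩
        map_add' := fun f g => by ext i; exact mul_add _ _ _
        map_smul' := fun r f => by ext i; exact mul_left_comm _ _ _ } |c| fun f => by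
      refine (lp.norm_mono (by norm_num) (y := c • f) (hle f)).trans ?_
      rw [norm_smul, Real.norm_eq_abs]
  refine ⟨(b.repr.symm.toContinuousLinearEquiv : _ →L[ℝ] E) ∘L D ∘L
    (b.repr.toContinuousLinearEquiv : E →L[ℝ] _), fun i => ?_⟩
  apply b.repr.injective
  ext j
  rw [map_smul, b.repr_self]
  change b.repr (b.repr.symm (D (b.repr (b i)))) j = _
  rw [LinearIsometryEquiv.apply_symm_apply, b.repr_self, lp.coeFn_smul, Pi.smul_apply]
  change d j * _ = _
  rw [lp.single_apply, smul_eq_mul]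
  by_cases hij : j = i
  · subst hij; rfl
  · simp [Pi.single_eq_of_ne hij]

end HilbertBasis

namespace SignalDetection

section Operators

variable {ι : Type*} {E F : Type*} [NormedAddCommGroup E] [InnerProductSpace ℝ E]
  [NormedAddCommGroup F] [InnerProductSpace ℝ F]

/-- The operator function `opFun g A` multiplies the vectors of an eigenbasis of `A` by the values
of `g` at the eigenvalues. Boundedness of `g` on the eigenvalues guarantees that the operator
exists, so that the definition by choice does not take its default value. -/
theorem opFun_apply_of_diagonal (b : HilbertBasis ι ℝ E) {A : E →L[ℝ] E} {s : ι → ℝ}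
    (hA : ∀ i, A (b i) = s i • b i) {g : ℝ → ℝ} {c : ℝ} (hg : ∀ i, |g (s i)| ≤ c) (i : ι) :
    opFun g A (b i) = g (s i) • b i := by
  have h : ∃ B : E →L[ℝ] E, ∀ (t : ℝ) (x : E), A x = t • x → B x = g t • x := by
    obtain ⟨B, hB⟩ := b.exists_diagonal (d := fun i => g (s i)) hg
    refine ⟨B, fun t x hx => ?_⟩
    refine (b.hasSum_inner_smul_map B x).unique ?_
    refine ((b.hasSum_inner_smul x).const_smul (g t)).congr_fun fun j => ?_
    rw [hB]
    have hj := b.inner_apply_of_diagonal hA j x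
    rw [hx, inner_smul_right] at hj
    rcases eq_or_ne (inner ℝ (b j) x) 0 with h0 | h0
    · simp [h0]
    · rw [mul_right_cancel₀ h0 hj, smul_comm]
  rw [opFun, dif_pos h]
  exact h.choose_spec _ _ (hA i)

variable [CompleteSpace E]

theorem opTrace_of_diagonal (b : HilbertBasis ι ℝ E) {B : E →L[ℝ] E} {d : ι → ℝ}
    (hd0 : ∀ i, 0 ≤ d i) (hB : ∀ i, B (b i) = d i • b i) :
    opTrace B = ∑' i, ENNReal.ofReal (d i) := by
  unfold opTrace
  set e := (exists_hilbertBasis ℝ E).choose_spec.choose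
  have h (x : E) : ENNReal.ofReal (inner ℝ (B x) x) =
      ∑' j, ENNReal.ofReal (d j) * ENNReal.ofReal (inner ℝ (b j) x ^ 2) := by
    have hs := (b.hasSum_inner_smul_map B x).mapL (innerSL ℝ x)
    have hs' : HasSum (fun j => d j * inner ℝ (b j) x ^ 2) (inner ℝ (B x) x) := by
      rw [real_inner_comm]
      refine hs.congr_fun fun j => ?_
      rw [innerSL_apply_apply, inner_smul_right, hB, inner_smul_right, real_inner_comm x (b j)]
      ring
    rw [← hs'.tsum_eq, ENNReal.ofReal_tsum_of_nonneg
      (fun j => mul_nonneg (hd0 j) (sq_nonneg _)) hs'.summable]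
    exact tsum_congr fun j => ENNReal.ofReal_mul (hd0 j)
  simp_rw [h]
  rw [ENNReal.tsum_comm]
  refine tsum_congr fun j => ?_
  rw [ENNReal.tsum_mul_left]
  simp_rw [real_inner_comm _ (b j)]
  rw [e.tsum_ofReal_inner_sq, b.orthonormal.1 j]
  simp

variable [CompleteSpace F]

theorem opTrace_normalOp (b : HilbertBasis ι ℝ F) (S : E →L[ℝ] F) :
    opTrace (normalOp S) = ∑' j, ENNReal.ofReal (‖ContinuousLinearMap.adjoint S (b j)‖ ^ 2) := by
  unfold opTrace normalOp
  set e := (exists_hilbertBasis ℝ E).choose_spec.choose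
  have h (x : E) : ENNReal.ofReal
      (inner ℝ (((ContinuousLinearMap.adjoint S).comp S) x) x) =
      ∑' j, ENNReal.ofReal (inner ℝ x (ContinuousLinearMap.adjoint S (b j)) ^ 2) := by
    rw [ContinuousLinearMap.comp_apply, ContinuousLinearMap.adjoint_inner_left,
      real_inner_self_eq_norm_sq, ← b.tsum_ofReal_inner_sq]
    refine tsum_congr fun j => ?_
    rw [ContinuousLinearMap.adjoint_inner_right, real_inner_comm]
  simp_rw [h]
  rw [ENNReal.tsum_comm]
  exact tsum_congr fun j => e.tsum_ofReal_inner_sq _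

theorem normalOp_isSymmetric (T : E →L[ℝ] F) :
    (normalOp T : E →ₗ[ℝ] E).IsSymmetric := by
  intro x y
  change inner ℝ (ContinuousLinearMap.adjoint T (T x)) y =
    inner ℝ x (ContinuousLinearMap.adjoint T (T y))
  rw [ContinuousLinearMap.adjoint_inner_left, ContinuousLinearMap.adjoint_inner_right]

theorem inner_normalOp_self (T : E →L[ℝ] F) (x : E) :
    inner ℝ (normalOp T x) x = ‖T x‖ ^ 2 := by
  change inner ℝ (ContinuousLinearMap.adjoint T (T x)) x = _
  rw [ContinuousLinearMap.adjoint_inner_left, real_inner_self_eq_norm_sq]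

/-- A Hilbert-Schmidt operator is the norm limit of its truncations to finitely many vectors of a
Hilbert basis. -/
theorem IsHilbertSchmidt.isCompactOperator {T : E →L[ℝ] F} (hT : IsHilbertSchmidt T) :
    IsCompactOperator T := by
  classical
  unfold IsHilbertSchmidt opTrace at hT
  set e := (exists_hilbertBasis ℝ E).choose_spec.choose
  simp_rw [inner_normalOp_self] at hT
  have hsum : Summable fun i => ‖T (e i)‖ ^ 2 := by
    refine (ENNReal.summable_toReal hT.ne).congr fun i => ?_
    exact ENNReal.toReal_ofReal (sq_nonneg _)
  let R : _ → E →L[ℝ] F := fun i => (innerSL ℝ (e i)).smulRight (T (e i))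
  have hR (i) (x : E) : R i x = inner ℝ (e i) x • T (e i) := by
    simp [R, ContinuousLinearMap.smulRight_apply]
  have hbound (t : Finset _) : ‖∑ i ∈ t, R i‖ ≤ √(∑ i ∈ t, ‖T (e i)‖ ^ 2) := by
    refine ContinuousLinearMap.opNorm_le_bound _ (Real.sqrt_nonneg _) fun x => ?_
    rw [_root_.sum_apply]
    calc ‖∑ i ∈ t, R i x‖ ≤ ∑ i ∈ t, ‖T (e i)‖ * |inner ℝ (e i) x| := by
          refine norm_sum_le_of_le _ fun i _ => ?_
          rw [hR, norm_smul, Real.norm_eq_abs, mul_comm]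
      _ ≤ √(∑ i ∈ t, ‖T (e i)‖ ^ 2) * √(∑ i ∈ t, |inner ℝ (e i) x| ^ 2) :=
          Real.sum_mul_le_sqrt_mul_sqrt _ _ _
      _ ≤ √(∑ i ∈ t, ‖T (e i)‖ ^ 2) * ‖x‖ := by
          gcongr
          rw [Real.sqrt_le_left (norm_nonneg _)]
          simp_rw [sq_abs]
          exact sum_le_hasSum t (fun _ _ => sq_nonneg _) (e.hasSum_inner_sq x)
  have hRsum : Summable R := by
    rw [summable_iff_vanishing_norm]
    intro ε hε
    obtain ⟨s, hs⟩ := summable_iff_vanishing_norm.1 hsum (ε ^ 2) (by positivity)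
    refine ⟨s, fun t ht => (hbound t).trans_lt ?_⟩
    rw [Real.sqrt_lt' hε]
    exact (le_abs_self _).trans_lt (hs t ht)
  have hlim : HasSum R T := by
    convert hRsum.hasSum
    ext x
    refine (e.hasSum_inner_smul_map T x).unique ?_
    simpa [hR] using hRsum.hasSum.mapL (ContinuousLinearMap.apply ℝ F x)
  refine isCompactOperator_of_tendsto hlim (Eventually.of_forall fun s => ?_)
  have hmem : ∑ i ∈ s, R i ∈ compactOperator (RingHom.id ℝ) E F := by
    refine Submodule.sum_mem _ fun i _ => ?_
    have h1 : IsCompactOperator (innerSL ℝ (e i)) :=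
      isCompactOperator_of_locallyCompactSpace_dom (innerSL ℝ (e i))
    exact h1.clm_comp (ContinuousLinearMap.toSpanSingleton ℝ (T (e i)))
  exact hmem

/-- Hilbert bases of the members of a total orthogonal family of subspaces combine to a Hilbert
basis of the whole space. -/
theorem exists_hilbertBasis_of_orthogonalFamily {κ : Type v} {E : Type u}
    [NormedAddCommGroup E] [InnerProductSpace ℝ E] [CompleteSpace E]
    {V : κ → Submodule ℝ E} (hc : ∀ k, CompleteSpace (V k))
    (hV : OrthogonalFamily ℝ (fun k => V k) fun k => (V k).subtypeₗᵢ) (hbot : (⨆ k, V k)ᗮ = ⊥) :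
    ∃ (ι : Type (max u v)) (b : HilbertBasis ι ℝ E) (k : ι → κ), ∀ i, b i ∈ V (k i) := by
  choose W c _ using fun k => exists_hilbertBasis ℝ (V k)
  have horth : Orthonormal ℝ fun a : Σ k, W k => (c a.1 a.2 : E) :=
    hV.orthonormal_sigma_orthonormal fun k => (c k).orthonormal
  have hbot' : (Submodule.span ℝ (Set.range fun a : Σ k, W k => (c a.1 a.2 : E)))ᗮ = ⊥ := by
    rw [eq_bot_iff, ← hbot]
    intro x hx
    suffices h : ⨆ k, V k ≤ (ℝ ∙ x)ᗮ from fun y hy =>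
      Submodule.mem_orthogonal_singleton_iff_inner_left.1 (h hy)
    refine iSup_le fun k y hy => ?_
    rw [Submodule.mem_orthogonal_singleton_iff_inner_right]
    have hs := ((c k).hasSum_inner_smul ⟨y, hy⟩).mapL ((innerSL ℝ x) ∘L (V k).subtypeL)
    refine hs.unique (hasSum_zero.congr_fun fun i => ?_)
    have h0 : inner ℝ (c k i : E) x = 0 := Submodule.mem_orthogonal _ _ |>.1 hx _
      (Submodule.subset_span (Set.mem_range_self (⟨k, i⟩ : Σ k, W k)))
    rw [ContinuousLinearMap.map_smul]
    refine mul_eq_zero_of_right _ ?_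
    change inner ℝ x (c k i : E) = 0
    rw [real_inner_comm, h0]
  refine ⟨_, HilbertBasis.mkOfOrthogonalEqBot horth hbot', fun a => a.1, fun a => ?_⟩
  rw [HilbertBasis.coe_mkOfOrthogonalEqBot]
  exact (c a.1 a.2).2

/-- Spectral theorem: a compact symmetric operator is diagonal in some Hilbert basis. -/
theorem exists_eigenbasis {E : Type u} [NormedAddCommGroup E] [InnerProductSpace ℝ E]
    [CompleteSpace E] {A : E →L[ℝ] E} (hA : IsCompactOperator A)
    (hA' : (A : E →ₗ[ℝ] E).IsSymmetric) :
    ∃ (ι : Type u) (b : HilbertBasis ι ℝ E) (s : ι → ℝ), ∀ i, A (b i) = s i • b i := by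
  have hclosed (μ : ℝ) : CompleteSpace (Module.End.eigenspace (A : Module.End ℝ E) μ) := by
    have h : IsClosed (Module.End.eigenspace (A : Module.End ℝ E) μ : Set E) := by
      convert! isClosed_eq A.continuous (continuous_const_smul μ) using 1
      ext x
      exact Module.End.mem_eigenspace_iff
    exact h.completeSpace_coe
  obtain ⟨ι, b, s, h⟩ := exists_hilbertBasis_of_orthogonalFamily hclosed
    hA'.orthogonalFamily_eigenspaces
    (ContinuousLinearMap.orthogonalComplement_iSup_eigenspaces_eq_bot hA hA')
  exact ⟨ι, b, s, fun i => Module.End.mem_eigenspace_iff.1 (h i)⟩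

end Operators

end SignalDetection

/-! ### Exponential moments of squares of Gaussian variables -/

theorem Real.exp_neg_sub_sq_le_one_sub {y : ℝ} (hy : |y| ≤ 1 / 2) :
    Real.exp (-y - y ^ 2) ≤ 1 - y := by
  have hy' := abs_le.1 hy
  have h1 : 0 < 1 - y := by linarith
  suffices h : 1 ≤ (1 - y) * Real.exp (y + y ^ 2) by
    have he : -y - y ^ 2 = -(y + y ^ 2) := by ring
    rw [he, Real.exp_neg, inv_le_iff_one_le_mul₀ (Real.exp_pos _)]
    exact h
  rcases le_total 0 y with h0 | h0
  · have h2 : 0 ≤ y + y ^ 2 := by positivity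
    have h3 : 1 ≤ (1 - y) * (1 + (y + y ^ 2) + (y + y ^ 2) ^ 2 / 2) := by
      have h4 : y ^ 2 ≤ 1 / 4 := by nlinarith
      have h5 : y ^ 3 ≤ 1 / 8 := by nlinarith
      have h6 : 0 ≤ y ^ 2 * (1 - y - y ^ 2 - y ^ 3) := by
        apply mul_nonneg (sq_nonneg _); linarith
      nlinarith
    exact h3.trans (mul_le_mul_of_nonneg_left (Real.quadratic_le_exp_of_nonneg h2) h1.le)
  · have h3 : 1 ≤ (1 - y) * (y + y ^ 2 + 1) := by nlinarith [sq_nonneg y]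
    exact h3.trans (mul_le_mul_of_nonneg_left (Real.add_one_le_exp _) h1.le)

namespace ProbabilityTheory

theorem lintegral_exp_sq_sub_gaussianReal_le (v : ℝ≥0) {θ : ℝ} (hθ : |θ| * v ≤ 1 / 4) :
    ∫⁻ x, ENNReal.ofReal (Real.exp (θ * (x ^ 2 - v))) ∂(gaussianReal 0 v) ≤
      ENNReal.ofReal (Real.exp (2 * θ ^ 2 * v ^ 2)) := by
  rcases eq_or_ne v 0 with rfl | hv
  · simp [gaussianReal_zero_var]
  have hv0 : (0 : ℝ) < v := by positivity
  set y : ℝ := 2 * (θ * v) with hy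
  have hy' : |y| ≤ 1 / 2 := by
    rw [hy, abs_mul, abs_mul, abs_of_pos hv0, abs_two]; linarith
  have hy1 : 0 < 1 - y := by linarith [(abs_le.1 hy').2]
  have hb : 0 < (1 - y) / (2 * v) := by positivity
  rw [gaussianReal_of_var_ne_zero _ hv,
    lintegral_withDensity_eq_lintegral_mul _ (measurable_gaussianPDF 0 v) (by fun_prop)]
  have hpt (x : ℝ) : (gaussianPDF 0 v * fun x => ENNReal.ofReal (Real.exp (θ * (x ^ 2 - v)))) x =
      ENNReal.ofReal ((√(2 * Real.pi * v))⁻¹ * Real.exp (-(θ * v)) *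
        Real.exp (-((1 - y) / (2 * v)) * x ^ 2)) := by
    rw [Pi.mul_apply, gaussianPDF_def, gaussianPDFReal_def,
      ← ENNReal.ofReal_mul (by positivity)]
    congr 1
    simp only [mul_assoc, ← Real.exp_add]
    congr 2
    rw [hy]
    field_simp
    ring
  simp_rw [hpt]
  rw [← ofReal_integral_eq_lintegral_ofReal
    ((integrable_exp_neg_mul_sq hb).const_mul _) (ae_of_all _ fun x => by positivity),
    integral_const_mul, integral_gaussian]
  refine ENNReal.ofReal_le_ofReal ?_
  have hs : √(Real.pi / ((1 - y) / (2 * v))) = √(2 * Real.pi * v) * (√(1 - y))⁻¹ := by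
    rw [← Real.sqrt_inv, ← Real.sqrt_mul (by positivity)]
    congr 1
    field_simp
  have hne : √(2 * Real.pi * v) ≠ 0 := by positivity
  have hval : (√(2 * Real.pi * v))⁻¹ * Real.exp (-(θ * v)) *
      √(Real.pi / ((1 - y) / (2 * v))) = Real.exp (-(θ * v)) * (√(1 - y))⁻¹ := by
    rw [hs]; field_simp
  rw [hval, ← div_eq_mul_inv, div_le_iff₀ (by positivity)]
  refine le_of_sq_le_sq ?_ (by positivity)
  rw [mul_pow, Real.sq_sqrt hy1.le, ← Real.exp_nat_mul, ← Real.exp_nat_mul]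
  have h := mul_le_mul_of_nonneg_left (Real.exp_neg_sub_sq_le_one_sub hy')
    (Real.exp_pos (2 * (2 * θ ^ 2 * v ^ 2))).le
  rw [← Real.exp_add] at h
  convert! h using 2
  · rw [hy]; push_cast; ring

end ProbabilityTheory

/-! ### Gaussian white noise -/

namespace SignalDetection

namespace IsGaussianWhiteNoise

variable {Ω : Type*} [MeasurableSpace Ω] {P : Measure Ω} {K : Type*} [NormedAddCommGroup K]
  [InnerProductSpace ℝ K] {ξ : K → Ω → ℝ}

theorem aemeasurable (hξ : IsGaussianWhiteNoise P ξ) (h : K) : AEMeasurable (ξ h) P :=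
  (hξ.hasLaw h).aemeasurable

theorem memLp_two (hξ : IsGaussianWhiteNoise P ξ) (h : K) : MemLp (ξ h) 2 P :=
  (hξ.hasLaw h).hasGaussianLaw.memLp_two

theorem integral_eq_zero (hξ : IsGaussianWhiteNoise P ξ) (h : K) : ∫ ω, ξ h ω ∂P = 0 := by
  rw [(hξ.hasLaw h).integral_eq, integral_id_gaussianReal]

theorem variance_eq (hξ : IsGaussianWhiteNoise P ξ) (h : K) : Var[ξ h; P] = ‖h‖ ^ 2 := by
  rw [(hξ.hasLaw h).variance_eq, variance_id_gaussianReal]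
  simp

theorem lintegral_sq (hξ : IsGaussianWhiteNoise P ξ) (h : K) :
    ∫⁻ ω, ENNReal.ofReal (ξ h ω ^ 2) ∂P = ENNReal.ofReal (‖h‖ ^ 2) := by
  rw [← ofReal_integral_eq_lintegral_ofReal (hξ.memLp_two h).integrable_sq
    (ae_of_all _ fun _ => sq_nonneg _), ← hξ.variance_eq h,
    variance_of_integral_eq_zero (hξ.aemeasurable h) (hξ.integral_eq_zero h)]

theorem map_zero (hξ : IsGaussianWhiteNoise P ξ) : ξ 0 =ᵐ[P] 0 := by
  filter_upwards [hξ.ae_smul 0 0] with ω h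
  simpa using h

theorem map_sum (hξ : IsGaussianWhiteNoise P ξ) {κ : Type*} (s : Finset κ) (c : κ → ℝ)
    (h : κ → K) : ξ (∑ i ∈ s, c i • h i) =ᵐ[P] fun ω => ∑ i ∈ s, c i * ξ (h i) ω := by
  classical
  induction s using Finset.induction_on with
  | empty => simpa using! hξ.map_zero
  | insert i s hi ih =>
    rw [Finset.sum_insert hi]
    filter_upwards [ih, hξ.ae_add (c i • h i) (∑ i ∈ s, c i • h i), hξ.ae_smul (c i) (h i)]
      with ω h1 h2 h3
    rw [h2, Finset.sum_insert hi, Pi.add_apply, h1, h3]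
    simp

variable [IsProbabilityMeasure P]

theorem covariance_eq_zero (hξ : IsGaussianWhiteNoise P ξ) {g h : K} (hgh : inner ℝ g h = 0) :
    cov[ξ g, ξ h; P] = 0 := by
  have h1 := variance_add (hξ.memLp_two g) (hξ.memLp_two h)
  rw [← variance_congr (hξ.ae_add g h), hξ.variance_eq, hξ.variance_eq, hξ.variance_eq,
    norm_add_sq_real, hgh] at h1
  linarith

theorem iIndepFun_of_orthogonal (hξ : IsGaussianWhiteNoise P ξ) {κ : Type*} [Finite κ] {h : κ → K}
    (hh : Pairwise fun i j => inner ℝ (h i) (h j) = 0) : iIndepFun (fun i => ξ (h i)) P := by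
  classical
  have := Fintype.ofFinite κ
  have hm : AEMeasurable (fun ω i => ξ (h i) ω) P := aemeasurable_pi_lambda _ fun i =>
    hξ.aemeasurable (h i)
  refine HasGaussianLaw.iIndepFun_of_covariance_eq_zero
    ⟨isGaussian_of_map_eq_gaussianReal fun L => ?_⟩ fun i j hij => hξ.covariance_eq_zero (hh hij)
  refine ⟨0, ‖∑ i, L (Pi.single i 1) • h i‖₊ ^ 2, ?_⟩
  rw [AEMeasurable.map_map_of_aemeasurable L.continuous.measurable.aemeasurable hm,
    ← (hξ.hasLaw (∑ i, L (Pi.single i 1) • h i)).map_eq]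
  refine Measure.map_congr ?_
  filter_upwards [hξ.map_sum Finset.univ (fun i => L (Pi.single i 1)) h] with ω hω
  rw [hω, Function.comp_apply]
  have := LinearMap.pi_apply_eq_sum_univ (L : (κ → ℝ) →ₗ[ℝ] ℝ) (fun i => ξ (h i) ω)
  simp only [ContinuousLinearMap.coe_coe] at this
  rw [this]
  refine Finset.sum_congr rfl fun i _ => ?_
  rw [smul_eq_mul, mul_comm]
  congr 2
  ext j
  simp [Pi.single_apply, eq_comm]

theorem lintegral_exp_sum_sq_le (hξ : IsGaussianWhiteNoise P ξ) {κ : Type*} {h : κ → K}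
    (hh : Pairwise fun i j => inner ℝ (h i) (h j) = 0) {θ : ℝ}
    (hθ : ∀ i, |θ| * ‖h i‖ ^ 2 ≤ 1 / 4) (s : Finset κ) :
    ∫⁻ ω, ENNReal.ofReal (Real.exp (θ * ∑ i ∈ s, (ξ (h i) ω ^ 2 - ‖h i‖ ^ 2))) ∂P ≤
      ENNReal.ofReal (Real.exp (2 * θ ^ 2 * ∑ i ∈ s, ‖h i‖ ^ 4)) := by
  have hind : iIndepFun (fun i : s => (hξ.aemeasurable (h i)).mk) P :=
    (hξ.iIndepFun_of_orthogonal (h := fun i : s => h i)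
      fun i j hij => hh (Subtype.coe_injective.ne hij)).congr
        fun i => (hξ.aemeasurable (h i)).ae_eq_mk
  let G : s → ℝ → ℝ≥0∞ := fun i x => ENNReal.ofReal (Real.exp (θ * (x ^ 2 - ‖h i‖ ^ 2)))
  have hG (i : s) : Measurable (G i) := by fun_prop
  have hprod := lintegral_prod_eq_prod_lintegral_of_indepFun Finset.univ
    (fun i : s => G i ∘ (hξ.aemeasurable (h i)).mk) (hind.comp G hG)
    fun i => (hG i).comp (hξ.aemeasurable (h i)).measurable_mk
  have hlhs : ∫⁻ ω, ENNReal.ofReal (Real.exp (θ * ∑ i ∈ s, (ξ (h i) ω ^ 2 - ‖h i‖ ^ 2))) ∂P =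
      ∫⁻ ω, ∏ i : s, (G i ∘ (hξ.aemeasurable (h i)).mk) ω ∂P := by
    refine lintegral_congr_ae ?_
    have hae : ∀ᵐ ω ∂P, ∀ i : s, ξ (h i) ω = (hξ.aemeasurable (h i)).mk _ ω :=
      ae_all_iff.2 fun i => (hξ.aemeasurable (h i)).ae_eq_mk
    filter_upwards [hae] with ω hω
    rw [Finset.mul_sum, Real.exp_sum, ENNReal.ofReal_prod_of_nonneg (fun _ _ => (Real.exp_pos _).le),
      ← Finset.prod_coe_sort]
    refine Finset.prod_congr rfl fun i _ => ?_
    simp only [G, Function.comp_apply, ← hω i]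
  rw [hlhs, hprod, Finset.mul_sum, Real.exp_sum,
    ENNReal.ofReal_prod_of_nonneg (fun _ _ => (Real.exp_pos _).le), ← Finset.prod_coe_sort s]
  refine Finset.prod_le_prod' fun i _ => ?_
  have hi : ∫⁻ ω, (G i ∘ (hξ.aemeasurable (h i)).mk) ω ∂P = ∫⁻ ω, G i (ξ (h i) ω) ∂P := by
    refine lintegral_congr_ae ?_
    filter_upwards [(hξ.aemeasurable (h i)).ae_eq_mk] with ω hω
    rw [Function.comp_apply, ← hω]
  rw [hi, (hξ.hasLaw (h i)).lintegral_comp (hG i).aemeasurable]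
  have := lintegral_exp_sq_sub_gaussianReal_le (‖h i‖₊ ^ 2) (θ := θ) (by simpa using hθ i)
  convert! this using 3
  simp [← pow_mul]

end IsGaussianWhiteNoise

end SignalDetection

namespace SignalDetection

namespace IsGaussianWhiteNoise

variable {Ω : Type*} [MeasurableSpace Ω] {P : Measure Ω} {K : Type*} [NormedAddCommGroup K]
  [InnerProductSpace ℝ K] {ξ : K → Ω → ℝ} {κ : Type*} [Countable κ] {h : κ → K}

theorem ae_summable_sq (hξ : IsGaussianWhiteNoise P ξ) (hsum : Summable fun k => ‖h k‖ ^ 2) :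
    ∀ᵐ ω ∂P, Summable fun k => ξ (h k) ω ^ 2 := by
  have hm (k : κ) : AEMeasurable (fun ω => ENNReal.ofReal (ξ (h k) ω ^ 2)) P :=
    ((hξ.aemeasurable (h k)).pow_const 2).ennreal_ofReal
  have hfin : ∫⁻ ω, ∑' k, ENNReal.ofReal (ξ (h k) ω ^ 2) ∂P ≠ ∞ := by
    rw [lintegral_tsum hm]
    simp_rw [hξ.lintegral_sq]
    exact hsum.tsum_ofReal_ne_top
  filter_upwards [ae_lt_top' (AEMeasurable.tsum hm) hfin] with ω hω
  refine (ENNReal.summable_toReal hω.ne).congr fun k => ?_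
  exact ENNReal.toReal_ofReal (sq_nonneg _)

/-- A limit of coordinates `ξ (g i)` along `g i → g` can be identified with `ξ g`, because `ξ` is
an isometry from `K` into `L²`. -/
theorem ae_eq_of_tendsto (hξ : IsGaussianWhiteNoise P ξ) {ι : Type*} {l : Filter ι} [l.NeBot]
    [l.IsCountablyGenerated] {g : ι → K} {g₀ : K} (hg : Tendsto g l (𝓝 g₀)) {X : Ω → ℝ}
    {Y : ι → Ω → ℝ} (hY : ∀ i, Y i =ᵐ[P] ξ (g i))
    (hX : ∀ᵐ ω ∂P, Tendsto (fun i => Y i ω) l (𝓝 (X ω))) : X =ᵐ[P] ξ g₀ := by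
  have hYm (i : ι) : AEMeasurable (Y i) P := (hξ.aemeasurable (g i)).congr (hY i).symm
  have hXm : AEMeasurable X P := aemeasurable_of_tendsto_metrizable_ae l hYm hX
  have hlim : Tendsto (fun i => ENNReal.ofReal (‖g i - g₀‖ ^ 2)) l (𝓝 0) := by
    have h1 : Tendsto (fun i => ‖g i - g₀‖ ^ 2) l (𝓝 0) := by
      simpa using (tendsto_iff_norm_sub_tendsto_zero.1 hg).pow 2
    simpa using ENNReal.tendsto_ofReal h1
  have heq (i : ι) : ∫⁻ ω, ENNReal.ofReal ((Y i ω - ξ g₀ ω) ^ 2) ∂P =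
      ENNReal.ofReal (‖g i - g₀‖ ^ 2) := by
    rw [← hξ.lintegral_sq]
    refine lintegral_congr_ae ?_
    filter_upwards [hY i, hξ.ae_add (g i - g₀) g₀] with ω h1 h2
    rw [sub_add_cancel] at h2
    rw [h1, h2, Pi.add_apply, add_sub_cancel_right]
  have hzero : ∫⁻ ω, ENNReal.ofReal ((X ω - ξ g₀ ω) ^ 2) ∂P = 0 := by
    refine le_antisymm ?_ zero_le
    calc ∫⁻ ω, ENNReal.ofReal ((X ω - ξ g₀ ω) ^ 2) ∂P
        = ∫⁻ ω, liminf (fun i => ENNReal.ofReal ((Y i ω - ξ g₀ ω) ^ 2)) l ∂P := by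
          refine lintegral_congr_ae ?_
          filter_upwards [hX] with ω hω
          exact (ENNReal.tendsto_ofReal ((hω.sub_const _).pow 2)).liminf_eq.symm
      _ ≤ liminf (fun i => ∫⁻ ω, ENNReal.ofReal ((Y i ω - ξ g₀ ω) ^ 2) ∂P) l :=
          lintegral_liminf_le' fun i =>
            (((hYm i).sub (hξ.aemeasurable g₀)).pow_const 2).ennreal_ofReal
      _ = 0 := by simp_rw [heq]; exact hlim.liminf_eq
  have hm : AEMeasurable (fun ω => ENNReal.ofReal ((X ω - ξ g₀ ω) ^ 2)) P :=
    ((hXm.sub (hξ.aemeasurable g₀)).pow_const 2).ennreal_ofReal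
  filter_upwards [(lintegral_eq_zero_iff' hm).1 hzero] with ω hω
  have h1 : (X ω - ξ g₀ ω) ^ 2 ≤ 0 := ENNReal.ofReal_eq_zero.1 hω
  exact sub_eq_zero.1 (pow_eq_zero_iff two_ne_zero |>.1 (le_antisymm h1 (sq_nonneg _)))

/-- The random series `∑ₖ ξ(hₖ) eₖ`, for `∑ₖ ‖hₖ‖² < ∞` and an orthonormal family `(eₖ)`. -/
theorem exists_random_series (hξ : IsGaussianWhiteNoise P ξ) {H : Type*} [NormedAddCommGroup H]
    [InnerProductSpace ℝ H] [CompleteSpace H] {e : κ → H} (he : Orthonormal ℝ e)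
    (hsum : Summable fun k => ‖h k‖ ^ 2) :
    ∃ Z : Ω → H, AEStronglyMeasurable Z P ∧
      (∀ᵐ ω ∂P, HasSum (fun k => ξ (h k) ω ^ 2) (‖Z ω‖ ^ 2)) ∧
      ∀ (w : H) (k₀ : K), HasSum (fun k => inner ℝ (e k) w • h k) k₀ →
        (fun ω => inner ℝ (Z ω) w) =ᵐ[P] ξ k₀ := by
  have hZ : ∀ᵐ ω ∂P, HasSum (fun k => ξ (h k) ω • e k) (∑' k, ξ (h k) ω • e k) := by
    filter_upwards [hξ.ae_summable_sq hsum] with ω hω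
    have := (he.orthogonalFamily.summable_iff_norm_sq_summable fun k => ξ (h k) ω).2
      (by simpa using hω)
    simpa using this.hasSum
  refine ⟨fun ω => ∑' k, ξ (h k) ω • e k, ?_, ?_, fun w k₀ hk₀ => ?_⟩
  · refine aestronglyMeasurable_of_tendsto_ae (atTop : Filter (Finset κ))
      (f := fun s ω => ∑ k ∈ s, ξ (h k) ω • e k) (fun s => ?_) hZ
    exact Finset.aestronglyMeasurable_fun_sum s fun k _ =>
      (hξ.aemeasurable (h k)).aestronglyMeasurable.smul_const (e k)
  · filter_upwards [hZ] with ω hω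
    have h1 : Tendsto (fun s : Finset κ => ‖∑ k ∈ s, ξ (h k) ω • e k‖ ^ 2) atTop
      (𝓝 (‖∑' k, ξ (h k) ω • e k‖ ^ 2)) := (Tendsto.norm hω).pow 2
    refine h1.congr fun s => ?_
    simpa using he.orthogonalFamily.norm_sum (fun k => ξ (h k) ω) s
  · refine hξ.ae_eq_of_tendsto (l := (atTop : Filter (Finset κ))) hk₀
      (Y := fun s ω => ∑ k ∈ s, inner ℝ (e k) w * ξ (h k) ω)
      (fun s => (hξ.map_sum s _ h).symm) ?_
    filter_upwards [hZ] with ω hω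
    have h1 := hω.mapL (innerSL ℝ w)
    rw [innerSL_apply_apply, real_inner_comm] at h1
    refine h1.congr_fun fun k => ?_
    rw [innerSL_apply_apply, inner_smul_right, real_inner_comm w, mul_comm]

omit [Countable κ] in
theorem measure_le_neg_le (hξ : IsGaussianWhiteNoise P ξ) (g : K) {s : ℝ} (hs : 0 < s) :
    P {ω | ξ g ω ≤ -s} ≤ ENNReal.ofReal (‖g‖ ^ 2 / s ^ 2) := by
  have hm : AEMeasurable (fun ω => ENNReal.ofReal (ξ g ω ^ 2)) P :=
    ((hξ.aemeasurable g).pow_const 2).ennreal_ofReal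
  calc P {ω | ξ g ω ≤ -s} ≤ P {ω | ENNReal.ofReal (s ^ 2) ≤ ENNReal.ofReal (ξ g ω ^ 2)} := by
        refine measure_mono fun ω hω => ENNReal.ofReal_le_ofReal ?_
        have : ξ g ω ≤ -s := hω
        nlinarith
    _ ≤ _ := meas_ge_le_lintegral_div hm (by simp; positivity) ENNReal.ofReal_ne_top
    _ = _ := by rw [hξ.lintegral_sq, ENNReal.ofReal_div_of_pos (by positivity)]

variable {W : Ω → ℝ}

theorem aemeasurable_of_hasSum (hξ : IsGaussianWhiteNoise P ξ)
    (hW : ∀ᵐ ω ∂P, HasSum (fun k => ξ (h k) ω ^ 2) (W ω)) : AEMeasurable W P :=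
  aemeasurable_of_tendsto_metrizable_ae (atTop : Filter (Finset κ))
    (f := fun s ω => ∑ k ∈ s, ξ (h k) ω ^ 2)
    (fun s => Finset.aemeasurable_fun_sum s fun k _ => (hξ.aemeasurable (h k)).pow_const 2) hW

variable [IsProbabilityMeasure P] {Λ v w : ℝ}

theorem lintegral_exp_le_of_hasSum (hξ : IsGaussianWhiteNoise P ξ)
    (hh : Pairwise fun i j => inner ℝ (h i) (h j) = 0)
    (hW : ∀ᵐ ω ∂P, HasSum (fun k => ξ (h k) ω ^ 2) (W ω))
    (hΛ : HasSum (fun k => ‖h k‖ ^ 2) Λ) (hv : ∀ s : Finset κ, ∑ k ∈ s, ‖h k‖ ^ 4 ≤ v ^ 2)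
    {θ : ℝ} (hθ : ∀ k, |θ| * ‖h k‖ ^ 2 ≤ 1 / 4) :
    ∫⁻ ω, ENNReal.ofReal (Real.exp (θ * (W ω - Λ))) ∂P ≤
      ENNReal.ofReal (Real.exp (2 * θ ^ 2 * v ^ 2)) := by
  calc ∫⁻ ω, ENNReal.ofReal (Real.exp (θ * (W ω - Λ))) ∂P
      = ∫⁻ ω, liminf (fun s : Finset κ => ENNReal.ofReal
          (Real.exp (θ * ∑ k ∈ s, (ξ (h k) ω ^ 2 - ‖h k‖ ^ 2)))) atTop ∂P := by
        refine lintegral_congr_ae ?_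
        filter_upwards [hW] with ω hω
        have h1 : Tendsto (fun s : Finset κ => ∑ k ∈ s, (ξ (h k) ω ^ 2 - ‖h k‖ ^ 2)) atTop
          (𝓝 (W ω - Λ)) := hω.sub hΛ
        exact (ENNReal.tendsto_ofReal
          ((Real.continuous_exp.tendsto _).comp (h1.const_mul θ))).liminf_eq.symm
    _ ≤ liminf (fun s : Finset κ => ∫⁻ ω, ENNReal.ofReal
          (Real.exp (θ * ∑ k ∈ s, (ξ (h k) ω ^ 2 - ‖h k‖ ^ 2))) ∂P) atTop := by
        refine lintegral_liminf_le' fun s => ?_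
        refine AEMeasurable.ennreal_ofReal (Real.measurable_exp.comp_aemeasurable ?_)
        refine AEMeasurable.const_mul ?_ θ
        exact Finset.aemeasurable_fun_sum s fun k _ =>
          ((hξ.aemeasurable (h k)).pow_const 2).sub_const _
    _ ≤ liminf (fun _ : Finset κ => ENNReal.ofReal (Real.exp (2 * θ ^ 2 * v ^ 2))) atTop := by
        refine liminf_le_liminf (Eventually.of_forall fun s => ?_)
        refine (hξ.lintegral_exp_sum_sq_le hh hθ s).trans ?_
        gcongr
        exact hv s
    _ = _ := liminf_const _

/-- Concentration of a weighted sum of squares of Gaussians around its mean, on both sides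
(`ε = ± 1`), with tails governed by the Hilbert-Schmidt norm `v` and the operator norm `w` of the
weights. -/
theorem measure_ge_le_exp (hξ : IsGaussianWhiteNoise P ξ)
    (hh : Pairwise fun i j => inner ℝ (h i) (h j) = 0)
    (hW : ∀ᵐ ω ∂P, HasSum (fun k => ξ (h k) ω ^ 2) (W ω))
    (hΛ : HasSum (fun k => ‖h k‖ ^ 2) Λ) (hv0 : 0 ≤ v)
    (hv : ∀ s : Finset κ, ∑ k ∈ s, ‖h k‖ ^ 4 ≤ v ^ 2) (hw0 : 0 < w) (hw : ∀ k, ‖h k‖ ^ 2 ≤ w)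
    {x : ℝ} (hx : 0 < x) {ε : ℝ} (hε : |ε| = 1) :
    P {ω | 3 * √x * (v + 4 * w * √x) ≤ ε * (W ω - Λ)} ≤ ENNReal.ofReal (Real.exp (-x)) := by
  have hsx : 0 < √x := Real.sqrt_pos.2 hx
  have hx2 : √x * √x = x := Real.mul_self_sqrt hx.le
  set v' := v + 4 * w * √x with hv'
  have hv'0 : 0 < v' := by positivity
  -- the exponent is limited by `4 θ w ≤ 1` and by `θ v ≤ √x`
  set θ := √x / v' with hθ
  have hθ0 : 0 < θ := by positivity
  have hθv' : θ * v' = √x := by rw [hθ]; field_simp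
  have hθw : θ * w ≤ 1 / 4 := by
    have h1 : √x * (4 * (θ * w)) ≤ √x * 1 := by nlinarith [mul_nonneg hθ0.le hv0]
    linarith [le_of_mul_le_mul_left h1 hsx]
  have hθv : θ * v ≤ √x := by nlinarith [mul_pos (mul_pos hθ0 hw0) hsx]
  have hexp := hξ.lintegral_exp_le_of_hasSum hh hW hΛ hv (θ := ε * θ) fun k => by
    rw [abs_mul, hε, one_mul, abs_of_pos hθ0]
    exact (mul_le_mul_of_nonneg_left (hw k) hθ0.le).trans hθw
  have hm : AEMeasurable (fun ω => ENNReal.ofReal (Real.exp (ε * θ * (W ω - Λ)))) P :=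
    (Real.measurable_exp.comp_aemeasurable
      (((hξ.aemeasurable_of_hasSum hW).sub_const Λ).const_mul (ε * θ))).ennreal_ofReal
  have hsq : ε ^ 2 = 1 := by rw [← sq_abs, hε, one_pow]
  calc P {ω | 3 * √x * v' ≤ ε * (W ω - Λ)}
      ≤ P {ω | ENNReal.ofReal (Real.exp (3 * x)) ≤
          ENNReal.ofReal (Real.exp (ε * θ * (W ω - Λ)))} := by
        refine measure_mono fun ω hω => ?_
        refine ENNReal.ofReal_le_ofReal (Real.exp_le_exp.2 ?_)
        have h1 := mul_le_mul_of_nonneg_left (show 3 * √x * v' ≤ ε * (W ω - Λ) from hω) hθ0.le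
        nlinarith
    _ ≤ _ := meas_ge_le_lintegral_div hm (by simp [Real.exp_pos]) ENNReal.ofReal_ne_top
    _ ≤ ENNReal.ofReal (Real.exp (2 * (ε * θ) ^ 2 * v ^ 2)) / ENNReal.ofReal (Real.exp (3 * x)) := by
        gcongr
    _ ≤ ENNReal.ofReal (Real.exp (-x)) := by
        rw [← ENNReal.ofReal_div_of_pos (Real.exp_pos _), ← Real.exp_sub]
        refine ENNReal.ofReal_le_ofReal (Real.exp_le_exp.2 ?_)
        have h1 : (θ * v) ^ 2 ≤ x := by nlinarith [mul_nonneg hθ0.le hv0]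
        rw [mul_pow, hsq]
        nlinarith

end IsGaussianWhiteNoise

end SignalDetection

/-! ### The statistic, its threshold, and the error of the second kind -/

theorem MeasureTheory.AEStronglyMeasurable.ae_eq_of_forall_inner {Ω H : Type*} [MeasurableSpace Ω]
    {P : Measure Ω} [NormedAddCommGroup H] [InnerProductSpace ℝ H] [CompleteSpace H] {X Y : Ω → H}
    (hX : AEStronglyMeasurable X P) (hY : AEStronglyMeasurable Y P)
    (h : ∀ w : H, (fun ω => inner ℝ (X ω) w) =ᵐ[P] fun ω => inner ℝ (Y ω) w) : X =ᵐ[P] Y := by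
  obtain ⟨t, ht, hD⟩ := (hX.sub hY).isSeparable_ae_range
  have h0 : X - Y =ᵐ[P] 0 := by
    refine ae_eq_zero_of_forall_dual_of_isSeparable ℝ ht (fun c => ?_) hD
    filter_upwards [h ((InnerProductSpace.toDual ℝ H).symm c)] with ω hω
    rw [real_inner_comm, InnerProductSpace.toDual_symm_apply, real_inner_comm,
      InnerProductSpace.toDual_symm_apply] at hω
    rw [Pi.sub_apply, map_sub, hω, sub_self, Pi.zero_apply]
  filter_upwards [h0] with ω hω
  exact sub_eq_zero.1 hω

namespace SignalDetection

section RandomElement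

variable {Ω H K : Type*} [MeasurableSpace Ω] {P : Measure Ω} [NormedAddCommGroup H]
  [InnerProductSpace ℝ H] [CompleteSpace H] [NormedAddCommGroup K] [InnerProductSpace ℝ K]
  [CompleteSpace K] {ξ : K → Ω → ℝ} {R : K →L[ℝ] H} {Z : Ω → H}

/-- If the random element `Z = R ξ` exists, then `R Y = R T f + σ R ξ`. -/
theorem applyToData_obs (hZ : AEStronglyMeasurable Z P)
    (hZξ : ∀ w : H, (fun ω => inner ℝ (Z ω) w) =ᵐ[P] ξ (ContinuousLinearMap.adjoint R w))
    (T : H →L[ℝ] K) (σ : ℝ) (f : H) :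
    applyToData P R (obs T ξ σ f) =ᵐ[P] fun ω => R (T f) + σ • Z ω := by
  have hm : AEStronglyMeasurable (fun ω => R (T f) + σ • Z ω) P :=
    aestronglyMeasurable_const.add (hZ.const_smul σ)
  have hi (w : H) : (fun ω => inner ℝ (R (T f) + σ • Z ω) w) =ᵐ[P]
      obs T ξ σ f (ContinuousLinearMap.adjoint R w) := by
    filter_upwards [hZξ w] with ω hω
    rw [obs, inner_add_left, real_inner_smul_left, hω, ContinuousLinearMap.adjoint_inner_right]
  have h : ∃ Z' : Ω → H, AEStronglyMeasurable Z' P ∧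
      ∀ w : H, (fun ω => inner ℝ (Z' ω) w) =ᵐ[P]
        obs T ξ σ f (ContinuousLinearMap.adjoint R w) := ⟨_, hm, hi⟩
  rw [applyToData, dif_pos h]
  exact h.choose_spec.1.ae_eq_of_forall_inner hm fun w => (h.choose_spec.2 w).trans (hi w).symm

theorem stat_obs (hZ : AEStronglyMeasurable Z P)
    (hZξ : ∀ w : H, (fun ω => inner ℝ (Z ω) w) =ᵐ[P] ξ (ContinuousLinearMap.adjoint R w))
    (T : H →L[ℝ] K) (σ : ℝ) (f : H) :
    stat P σ R (obs T ξ σ f) =ᵐ[P] fun ω => ‖R (T f)‖ ^ 2 +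
      2 * σ * ξ (ContinuousLinearMap.adjoint R (R (T f))) ω +
        σ ^ 2 * (‖Z ω‖ ^ 2 - (opTrace (normalOp R)).toReal) := by
  filter_upwards [applyToData_obs hZ hZξ T σ f, hZξ (R (T f))] with ω h1 h2
  rw [stat, h1, varSq, norm_add_sq_real, norm_smul, real_inner_smul_right,
    real_inner_comm, h2, mul_pow, Real.norm_eq_abs, sq_abs]
  ring

theorem threshold_le [IsProbabilityMeasure P] {T : H →L[ℝ] K} {σ α t : ℝ} (hα : α < 1)
    (hm : AEMeasurable (stat P σ R (obs T ξ σ 0)) P)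
    (ht : P {ω | t < stat P σ R (obs T ξ σ 0) ω} ≤ ENNReal.ofReal α) (hα0 : 0 ≤ α) :
    threshold P T ξ σ α R ≤ t := by
  have : IsProbabilityMeasure (P.map (stat P σ R (obs T ξ σ 0))) :=
    Measure.isProbabilityMeasure_map hm
  refine csInf_le ?_ ?_
  · -- the distribution function is below `1 - α > 0` near `-∞`
    obtain ⟨c, hc⟩ := ((tendsto_cdf_atBot (P.map (stat P σ R (obs T ξ σ 0)))).eventually
      (gt_mem_nhds (sub_pos.2 hα))).exists_forall_of_atBot
    exact ⟨c, fun y hy => le_of_not_ge fun hyc => (hc y hyc).not_ge hy⟩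
  · change 1 - α ≤ cdf _ t
    rw [cdf_eq_real, ← compl_Ioi, probReal_compl_eq_one_sub measurableSet_Ioi]
    have h1 : (P.map (stat P σ R (obs T ξ σ 0))).real (Ioi t) ≤ α := by
      rw [map_measureReal_apply_of_aemeasurable hm measurableSet_Ioi]
      exact ENNReal.toReal_le_of_le_ofReal hα0 ht
    linarith

end RandomElement

section Diagonal

variable {ι Ω H K : Type*} [MeasurableSpace Ω] {P : Measure Ω} [IsProbabilityMeasure P]
  [NormedAddCommGroup H] [InnerProductSpace ℝ H] [CompleteSpace H] [NormedAddCommGroup K]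
  [InnerProductSpace ℝ K] [CompleteSpace K] {ξ : K → Ω → ℝ} {R : K →L[ℝ] H}
  {b : HilbertBasis ι ℝ H} {lam : ι → ℝ}

theorem inner_adjoint_of_diagonal (hR : ∀ i, R (ContinuousLinearMap.adjoint R (b i)) = lam i • b i)
    (i : ι) (x : H) : inner ℝ (ContinuousLinearMap.adjoint R (b i))
      (ContinuousLinearMap.adjoint R x) = lam i * inner ℝ (b i) x := by
  rw [ContinuousLinearMap.adjoint_inner_right, hR, real_inner_smul_left]

theorem norm_adjoint_sq_of_diagonal
    (hR : ∀ i, R (ContinuousLinearMap.adjoint R (b i)) = lam i • b i) (i : ι) :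
    ‖ContinuousLinearMap.adjoint R (b i)‖ ^ 2 = lam i := by
  rw [← real_inner_self_eq_norm_sq, inner_adjoint_of_diagonal hR, real_inner_self_eq_norm_sq,
    b.orthonormal.1 i]
  simp

theorem norm_adjoint_sq_le (hR : ∀ i, R (ContinuousLinearMap.adjoint R (b i)) = lam i • b i)
    {w : ℝ} (hw0 : 0 ≤ w) (hw : ∀ i, lam i ≤ w) (y : H) :
    ‖ContinuousLinearMap.adjoint R y‖ ^ 2 ≤ w * ‖y‖ ^ 2 := by
  have hB : ∀ i, (R ∘L ContinuousLinearMap.adjoint R) (b i) = lam i • b i := hR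
  have hle := b.norm_apply_le_of_diagonal hw0 hB (fun i => by
    rw [abs_of_nonneg ((sq_nonneg _).trans_eq (norm_adjoint_sq_of_diagonal hR i))]
    exact hw i) y
  rw [← real_inner_self_eq_norm_sq, ContinuousLinearMap.adjoint_inner_left]
  calc inner ℝ y (R (ContinuousLinearMap.adjoint R y))
      ≤ ‖y‖ * ‖(R ∘L ContinuousLinearMap.adjoint R) y‖ := real_inner_le_norm _ _
    _ ≤ ‖y‖ * (w * ‖y‖) := by gcongr
    _ = w * ‖y‖ ^ 2 := by ring

/-- The random element `Z = R ξ` exists when `R R*` is diagonal with summable eigenvalues, and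
`‖Z‖²` concentrates around `tr (R* R)`. -/
theorem exists_noise (hξ : IsGaussianWhiteNoise P ξ)
    (hR : ∀ i, R (ContinuousLinearMap.adjoint R (b i)) = lam i • b i) (hsum : Summable lam)
    {v w : ℝ} (hv0 : 0 ≤ v) (hv : ∀ s : Finset ι, ∑ i ∈ s, lam i ^ 2 ≤ v ^ 2) (hw0 : 0 < w)
    (hw : ∀ i, lam i ≤ w) :
    ∃ Z : Ω → H, AEStronglyMeasurable Z P ∧
      (∀ y : H, (fun ω => inner ℝ (Z ω) y) =ᵐ[P] ξ (ContinuousLinearMap.adjoint R y)) ∧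
      ∀ x ε : ℝ, 0 < x → |ε| = 1 →
        P {ω | 3 * √x * (v + 4 * w * √x) ≤ ε * (‖Z ω‖ ^ 2 - (opTrace (normalOp R)).toReal)} ≤
          ENNReal.ofReal (Real.exp (-x)) := by
  -- `H` may be non-separable, but only countably many coordinates carry noise
  have hc : Countable (Function.support lam) := hsum.countable_support
  obtain ⟨h, hh⟩ : ∃ h : Function.support lam → K,
    ∀ i, h i = ContinuousLinearMap.adjoint R (b i) := ⟨_, fun _ => rfl⟩
  have hnorm (i : ι) := norm_adjoint_sq_of_diagonal hR i
  have hzero (i : ι) (hi : lam i = 0) : ContinuousLinearMap.adjoint R (b i) = 0 := by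
    have := hnorm i
    rw [hi] at this
    exact norm_eq_zero.1 (pow_eq_zero_iff two_ne_zero |>.1 this)
  have horth : Pairwise fun i j => inner ℝ (h i) (h j) = 0 := fun i j hij => by
    beta_reduce
    rw [hh, hh, inner_adjoint_of_diagonal hR,
      b.orthonormal.2 (Subtype.coe_injective.ne hij), mul_zero]
  have hΛ : HasSum (fun i => ‖h i‖ ^ 2) (opTrace (normalOp R)).toReal := by
    have h1 : HasSum lam (opTrace (normalOp R)).toReal := by
      rw [opTrace_normalOp b R]
      simp_rw [hnorm]
      have h0 (i : ι) : 0 ≤ lam i := hnorm i ▸ sq_nonneg _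
      rw [← ENNReal.ofReal_tsum_of_nonneg h0 hsum, ENNReal.toReal_ofReal (tsum_nonneg h0)]
      exact hsum.hasSum
    have h2 := (hasSum_subtype_support (f := lam)).2 h1
    exact h2.congr_fun fun i => by rw [hh, hnorm, Function.comp_apply]
  obtain ⟨Z, hZ, hZsq, hZξ⟩ := hξ.exists_random_series (e := fun i : Function.support lam => b i)
    (b.orthonormal.comp _ Subtype.coe_injective) hΛ.summable
  refine ⟨Z, hZ, fun y => ?_, fun x ε hx hε => ?_⟩
  · refine hZξ y _ ?_
    have h1 := b.hasSum_inner_smul_map (ContinuousLinearMap.adjoint R) y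
    have hsupp : Function.support
        (fun i => inner ℝ (b i) y • ContinuousLinearMap.adjoint R (b i)) ⊆
          Function.support lam := by
      intro i hi h0
      exact hi (by simp only [hzero i h0, smul_zero])
    have h2 := (hasSum_subtype_iff_of_support_subset hsupp).2 h1
    exact h2.congr_fun fun i => by rw [hh, Function.comp_apply]
  · refine hξ.measure_ge_le_exp horth hZsq hΛ hv0 (fun s => ?_) hw0
      (fun i => by rw [hh, hnorm]; exact hw i) hx hε
    have h1 := hv (s.map (Function.Embedding.subtype _))
    rw [Finset.sum_map] at h1
    refine le_trans (le_of_eq (Finset.sum_congr rfl fun i _ => ?_)) h1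
    rw [hh, Function.Embedding.subtype_apply, ← hnorm i, ← pow_mul]

/-- Error of the second kind: the test based on `R` detects `f` as soon as `‖R T f‖` dominates the
fluctuations of the statistic. -/
theorem measureReal_stat_le_threshold_le (hξ : IsGaussianWhiteNoise P ξ)
    (hR : ∀ i, R (ContinuousLinearMap.adjoint R (b i)) = lam i • b i) (hsum : Summable lam)
    {v w : ℝ} (hv0 : 0 ≤ v) (hv : ∀ s : Finset ι, ∑ i ∈ s, lam i ^ 2 ≤ v ^ 2) (hw0 : 0 < w)
    (hw : ∀ i, lam i ≤ w) {x α β σ : ℝ} (hx : 0 < x) (hα : α ∈ Ioo (0 : ℝ) 1) (hβ : 0 < β)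
    (hxα : Real.exp (-x) ≤ α) (hxβ : Real.exp (-x) ≤ β / 2) (hσ : 0 < σ) (T : H →L[ℝ] K) {f : H}
    (hf : 0 < ‖R (T f)‖)
    (hsep : 2 * σ * (‖R (T f)‖ * √(2 * w / β)) + 2 * (σ ^ 2 * (3 * √x * (v + 4 * w * √x))) ≤
      ‖R (T f)‖ ^ 2) :
    P.real {ω | stat P σ R (obs T ξ σ f) ω ≤ threshold P T ξ σ α R} ≤ β := by
  obtain ⟨Z, hZ, hZξ, hconc⟩ := exists_noise hξ hR hsum hv0 hv hw0 hw
  set t := 3 * √x * (v + 4 * w * √x) with ht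
  set Λ := (opTrace (normalOp R)).toReal with hΛ
  set m := ‖R (T f)‖ with hm
  set g := ContinuousLinearMap.adjoint R (R (T f)) with hg
  have hstat0 : stat P σ R (obs T ξ σ 0) =ᵐ[P] fun ω => σ ^ 2 * (‖Z ω‖ ^ 2 - Λ) := by
    filter_upwards [stat_obs hZ hZξ T σ 0, hξ.map_zero] with ω h1 h2
    rw [h1]
    simp [h2, hΛ]
  have hthr : threshold P T ξ σ α R ≤ σ ^ 2 * t := by
    refine threshold_le hα.2 ?_ ?_ hα.1.le
    · exact (((hZ.norm.aemeasurable.pow_const 2).sub_const Λ).const_mul (σ ^ 2)).congr hstat0.symm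
    · calc P {ω | σ ^ 2 * t < stat P σ R (obs T ξ σ 0) ω}
          ≤ P {ω | t ≤ 1 * (‖Z ω‖ ^ 2 - Λ)} := by
            refine measure_mono_ae ?_
            filter_upwards [hstat0] with ω h1 (h2 : _ < _)
            rw [h1] at h2
            change t ≤ 1 * (‖Z ω‖ ^ 2 - Λ)
            rw [one_mul]
            exact (lt_of_mul_lt_mul_left h2 (sq_nonneg σ)).le
        _ ≤ ENNReal.ofReal (Real.exp (-x)) := hconc x 1 hx (by simp)
        _ ≤ _ := ENNReal.ofReal_le_ofReal hxα
  have hs : 0 < m * √(2 * w / β) := by positivity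
  have hcross : P {ω | ξ g ω ≤ -(m * √(2 * w / β))} ≤ ENNReal.ofReal (β / 2) := by
    refine (hξ.measure_le_neg_le g hs).trans (ENNReal.ofReal_le_ofReal ?_)
    rw [mul_pow, Real.sq_sqrt (by positivity), div_le_iff₀ (by positivity)]
    refine (norm_adjoint_sq_le hR hw0.le hw _).trans_eq ?_
    field_simp
    rfl
  refine ENNReal.toReal_le_of_le_ofReal hβ.le ?_
  calc P {ω | stat P σ R (obs T ξ σ f) ω ≤ threshold P T ξ σ α R}
      ≤ P ({ω | t ≤ (-1) * (‖Z ω‖ ^ 2 - Λ)} ∪ {ω | ξ g ω ≤ -(m * √(2 * w / β))}) := by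
        refine measure_mono_ae ?_
        filter_upwards [stat_obs hZ hZξ T σ f] with ω h1 (h2 : _ ≤ _)
        by_contra hcon
        have hcon' : ¬ (t ≤ (-1) * (‖Z ω‖ ^ 2 - Λ) ∨ ξ g ω ≤ -(m * √(2 * w / β))) := hcon
        push Not at hcon'
        have h3 := mul_lt_mul_of_pos_left hcon'.1 (pow_pos hσ 2)
        have h4 := mul_lt_mul_of_pos_left hcon'.2 hσ
        have h5 : stat P σ R (obs T ξ σ f) ω = m ^ 2 + 2 * σ * ξ g ω +
          σ ^ 2 * (‖Z ω‖ ^ 2 - Λ) := h1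
        rw [h5] at h2
        linarith
    _ ≤ _ := measure_union_le _ _
    _ ≤ ENNReal.ofReal (β / 2) + ENNReal.ofReal (β / 2) := by
        gcongr
        exact (hconc x (-1) hx (by simp)).trans (ENNReal.ofReal_le_ofReal hxβ)
    _ = ENNReal.ofReal β := by
        rw [← ENNReal.ofReal_add (by positivity) (by positivity), add_halves]

end Diagonal

end SignalDetection

/-! ### Spectral form of the reconstruction operators and of the effective dimension -/

namespace SignalDetection

section Spectral

variable {ι H K : Type*} [NormedAddCommGroup H] [InnerProductSpace ℝ H] [CompleteSpace H]
  [NormedAddCommGroup K] [InnerProductSpace ℝ K] [CompleteSpace K] {T : H →L[ℝ] K}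
  {b : HilbertBasis ι ℝ H} {s : ι → ℝ}

theorem eigenvalue_nonneg (hA : ∀ i, normalOp T (b i) = s i • b i) (i : ι) : 0 ≤ s i := by
  have h := inner_normalOp_self T (b i)
  rw [hA, real_inner_smul_left, real_inner_self_eq_norm_sq, b.orthonormal.1 i] at h
  rw [one_pow, mul_one] at h
  rw [h]
  positivity

theorem eigenvalue_mem_Icc (hA : ∀ i, normalOp T (b i) = s i • b i) (i : ι) :
    s i ∈ Icc 0 ‖normalOp T‖ := by
  refine ⟨eigenvalue_nonneg hA i, ?_⟩
  have h := (normalOp T).le_opNorm (b i)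
  rw [hA, norm_smul, b.orthonormal.1 i, mul_one, mul_one] at h
  exact (le_abs_self _).trans h

theorem summable_eigenvalues (hA : ∀ i, normalOp T (b i) = s i • b i) (hT : IsHilbertSchmidt T) :
    Summable s := by
  rw [IsHilbertSchmidt, opTrace_of_diagonal b (eigenvalue_nonneg hA) hA] at hT
  exact (ENNReal.summable_toReal hT.ne).congr fun i =>
    ENNReal.toReal_ofReal (eigenvalue_nonneg hA i)

theorem summable_div_add (hA : ∀ i, normalOp T (b i) = s i • b i) (hT : IsHilbertSchmidt T)
    {τ : ℝ} (hτ : 0 < τ) : Summable fun i => s i / (s i + τ) := by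
  have h0 := eigenvalue_nonneg hA
  refine Summable.of_nonneg_of_le (fun i => div_nonneg (h0 i) (add_nonneg (h0 i) hτ.le))
    (fun i => ?_) ((summable_eigenvalues hA hT).mul_right τ⁻¹)
  rw [← div_eq_mul_inv]
  exact div_le_div_of_nonneg_left (h0 i) hτ (le_add_of_nonneg_left (h0 i))

theorem hasSum_effDim (hA : ∀ i, normalOp T (b i) = s i • b i) (hT : IsHilbertSchmidt T)
    {τ : ℝ} (hτ : 0 < τ) : HasSum (fun i => s i / (s i + τ)) (effDim (normalOp T) τ) := by
  have h0 := eigenvalue_nonneg hA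
  have hpos (i : ι) : 0 < s i + τ := add_pos_of_nonneg_of_pos (h0 i) hτ
  obtain ⟨B, hB⟩ := b.exists_diagonal (d := fun i => (s i + τ)⁻¹) (c := τ⁻¹) fun i => by
    rw [abs_of_pos (inv_pos.2 (hpos i))]
    exact inv_anti₀ hτ (le_add_of_nonneg_left (h0 i))
  have hAτ (i : ι) : (normalOp T + τ • (1 : H →L[ℝ] H)) (b i) = (s i + τ) • b i := by
    rw [_root_.add_apply, hA, _root_.smul_apply, one_apply_eq_self, add_smul]
  have hBA : B * (normalOp T + τ • (1 : H →L[ℝ] H)) = 1 := b.ext_clm fun i => by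
    rw [mul_apply_eq_comp, hAτ, map_smul, hB, smul_smul,
      mul_inv_cancel₀ (hpos i).ne', one_smul, one_apply_eq_self]
  have hAB : (normalOp T + τ • (1 : H →L[ℝ] H)) * B = 1 := b.ext_clm fun i => by
    rw [mul_apply_eq_comp, hB, map_smul, hAτ, smul_smul,
      inv_mul_cancel₀ (hpos i).ne', one_smul, one_apply_eq_self]
  have hinv : Ring.inverse (normalOp T + τ • (1 : H →L[ℝ] H)) = B :=
    Ring.inverse_unit ⟨_, B, hAB, hBA⟩
  have hd0 (i : ι) : 0 ≤ s i / (s i + τ) := div_nonneg (h0 i) (hpos i).le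
  have hsum := summable_div_add hA hT hτ
  rw [effDim, hinv, opTrace_of_diagonal b hd0 fun i => by
    rw [mul_apply_eq_comp, hA, map_smul, hB, smul_smul, div_eq_mul_inv],
    ← ENNReal.ofReal_tsum_of_nonneg hd0 hsum, ENNReal.toReal_ofReal (tsum_nonneg hd0)]
  exact hsum.hasSum

theorem IsHilbertSchmidt.exists_eigenbasis_normalOp {H : Type u} [NormedAddCommGroup H]
    [InnerProductSpace ℝ H] [CompleteSpace H] {T : H →L[ℝ] K} (hT : IsHilbertSchmidt T) :
    ∃ (ι : Type u) (b : HilbertBasis ι ℝ H) (s : ι → ℝ), ∀ i, normalOp T (b i) = s i • b i :=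
  exists_eigenbasis (hT.isCompactOperator.clm_comp (ContinuousLinearMap.adjoint T))
    (normalOp_isSymmetric T)

theorem effDim_nonneg (T : H →L[ℝ] K) (τ : ℝ) : 0 ≤ effDim (normalOp T) τ :=
  ENNReal.toReal_nonneg

theorem effDim_anti (hT : IsHilbertSchmidt T) {τ τ' : ℝ} (hτ : 0 < τ) (h : τ ≤ τ') :
    effDim (normalOp T) τ' ≤ effDim (normalOp T) τ := by
  obtain ⟨ι, b, s, hA⟩ := hT.exists_eigenbasis_normalOp
  refine hasSum_le (fun i => ?_) (hasSum_effDim hA hT (hτ.trans_le h)) (hasSum_effDim hA hT hτ)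
  have h0 := eigenvalue_nonneg hA i
  exact div_le_div_of_nonneg_left h0 (by positivity) (by linarith)

theorem mul_effDim_mono (hT : IsHilbertSchmidt T) {τ τ' : ℝ} (hτ : 0 < τ) (h : τ ≤ τ') :
    τ * effDim (normalOp T) τ ≤ τ' * effDim (normalOp T) τ' := by
  obtain ⟨ι, b, s, hA⟩ := hT.exists_eigenbasis_normalOp
  have hτ' := hτ.trans_le h
  refine hasSum_le (fun i => ?_) ((hasSum_effDim hA hT hτ).mul_left τ)
    ((hasSum_effDim hA hT hτ').mul_left τ')
  have h0 := eigenvalue_nonneg hA i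
  rw [← mul_div_assoc, ← mul_div_assoc, div_le_div_iff₀ (by positivity) (by positivity)]
  nlinarith [mul_nonneg (mul_nonneg h0 h0) (sub_nonneg.2 h)]

theorem exists_mul_effDim_le (hT : IsHilbertSchmidt T) :
    ∃ S : ℝ, ∀ τ, 0 < τ → τ * effDim (normalOp T) τ ≤ S := by
  obtain ⟨ι, b, s, hA⟩ := hT.exists_eigenbasis_normalOp
  refine ⟨∑' i, s i, fun τ hτ => hasSum_le (fun i => ?_) ((hasSum_effDim hA hT hτ).mul_left τ)
    (summable_eigenvalues hA hT).hasSum⟩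
  have h0 := eigenvalue_nonneg hA i
  rw [← mul_div_assoc, div_le_iff₀ (by positivity)]
  nlinarith

theorem effDim_pos (hT : IsHilbertSchmidt T) (ha : 0 < ‖normalOp T‖) {τ : ℝ} (hτ : 0 < τ) :
    0 < effDim (normalOp T) τ := by
  obtain ⟨ι, b, s, hA⟩ := hT.exists_eigenbasis_normalOp
  have h0 := eigenvalue_nonneg hA
  obtain ⟨i, hi⟩ : ∃ i, s i ≠ 0 := by
    by_contra! hcon
    have hzero : normalOp T = 0 := b.ext_clm fun i => by
      rw [hA, hcon, zero_smul, _root_.zero_apply]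
    rw [hzero, norm_zero] at ha
    exact ha.false
  have hi0 : 0 < s i := (h0 i).lt_of_ne' hi
  exact (div_pos hi0 (by positivity)).trans_le (le_hasSum (hasSum_effDim hA hT hτ) i
    fun j _ => div_nonneg (h0 j) (add_nonneg (h0 j) hτ.le))

theorem sqrt_effDim_div_anti (hT : IsHilbertSchmidt T) {τ τ' : ℝ} (hτ : 0 < τ) (h : τ ≤ τ') :
    √(effDim (normalOp T) τ') / τ' ≤ √(effDim (normalOp T) τ) / τ := by
  have := effDim_anti hT hτ h
  gcongr

variable {g : ℝ → ℝ → ℝ} {τ c : ℝ}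

theorem reconOp_comp_apply (hA : ∀ i, normalOp T (b i) = s i • b i)
    (hg : ∀ i, |g τ (s i)| ≤ c) (i : ι) :
    reconOp T g τ (T (b i)) = (s i * g τ (s i)) • b i := by
  change opFun (g τ) (normalOp T) (normalOp T (b i)) = _
  rw [hA, map_smul, opFun_apply_of_diagonal b hA hg, smul_smul]

theorem reconOp_adjoint_apply (hA : ∀ i, normalOp T (b i) = s i • b i)
    (hg : ∀ i, |g τ (s i)| ≤ c) (i : ι) :
    reconOp T g τ (ContinuousLinearMap.adjoint (reconOp T g τ) (b i)) =
      (s i * g τ (s i) ^ 2) • b i := by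
  have hadj : ContinuousLinearMap.adjoint (reconOp T g τ) (b i) = g τ (s i) • T (b i) := by
    refine ext_inner_right ℝ fun y => ?_
    rw [ContinuousLinearMap.adjoint_inner_left, real_inner_smul_left]
    change inner ℝ (b i) (opFun (g τ) (normalOp T) (ContinuousLinearMap.adjoint T y)) = _
    rw [b.inner_apply_of_diagonal (opFun_apply_of_diagonal b hA hg),
      ContinuousLinearMap.adjoint_inner_right]
  rw [hadj, map_smul, reconOp_comp_apply hA hg, smul_smul]
  congr 1
  ring

/-- The qualification bounds the bias of the reconstruction on the source set. -/
theorem norm_reconOp_sub_le (hA : ∀ i, normalOp T (b i) = s i • b i)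
    (hg : ∀ i, |g τ (s i)| ≤ c) {φ : ℝ → ℝ} {γ : ℝ}
    (hφ : IsIndexFunction ‖normalOp T‖ φ) (hq : HasQualification ‖normalOp T‖ g φ γ)
    (hτ : τ ∈ Ioc 0 ‖normalOp T‖) {f : H} (hf : f ∈ sourceSet T φ) :
    ‖reconOp T g τ (T f) - f‖ ≤ |γ| * φ τ := by
  obtain ⟨w, hw, rfl⟩ := hf
  have hs := eigenvalue_mem_Icc hA
  have h0mem : (0 : ℝ) ∈ Icc 0 ‖normalOp T‖ := ⟨le_rfl, norm_nonneg _⟩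
  have hφ0 (t : ℝ) (ht : t ∈ Icc 0 ‖normalOp T‖) : 0 ≤ φ t :=
    hφ.map_zero ▸ hφ.monotoneOn h0mem ht ht.1
  have hφb (i : ι) : |φ (s i)| ≤ φ ‖normalOp T‖ := by
    rw [abs_of_nonneg (hφ0 _ (hs i))]
    exact hφ.monotoneOn (hs i) ⟨norm_nonneg _, le_rfl⟩ (hs i).2
  have hφτ : 0 ≤ φ τ := hφ0 τ ⟨hτ.1.le, hτ.2⟩
  have hD : ∀ i, ((reconOp T g τ ∘L T) ∘L opFun φ (normalOp T) - opFun φ (normalOp T)) (b i) =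
      ((s i * g τ (s i) - 1) * φ (s i)) • b i := fun i => by
    rw [_root_.sub_apply, ContinuousLinearMap.comp_apply, opFun_apply_of_diagonal b hA hφb,
      map_smul, ContinuousLinearMap.comp_apply, reconOp_comp_apply hA hg, smul_smul, ← sub_smul]
    congr 1
    ring
  have hle := b.norm_apply_le_of_diagonal (c := |γ| * φ τ) (by positivity) hD (fun i => by
    rw [abs_mul, abs_sub_comm, abs_of_nonneg (hφ0 _ (hs i))]
    exact (hq τ hτ _ (hs i)).trans (mul_le_mul_of_nonneg_right (le_abs_self γ) hφτ)) w
  exact hle.trans (mul_le_of_le_one_right (by positivity) hw)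

/-- With `y = g_τ(t)`, the eigenvalue `t y²` of `R_τ R_τ*` is of order `1 / τ`, and its square is
of order `τ⁻² t / (t + τ)`, a summand of `τ⁻² N(τ)`. -/
theorem mul_sq_bounds {γ₁ γs t y : ℝ} (hτ : 0 < τ) (ht : 0 ≤ t) (h1 : |1 - t * y| ≤ γ₁)
    (h2 : τ * |y| ≤ γs) :
    t * y ^ 2 ≤ (1 + |γ₁| + |γs|) ^ 2 / τ ∧
      (t * y ^ 2) ^ 2 ≤ ((1 + |γ₁| + |γs|) ^ 2 / τ) ^ 2 * (t / (t + τ)) := by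
  have hty : t * |y| ≤ 1 + |γ₁| := by
    have h3 : |t * y| ≤ |1 - t * y| + 1 := by
      have := abs_sub (1 - t * y) 1
      have h4 : 1 - t * y - 1 = -(t * y) := by ring
      rw [h4, abs_neg, abs_one] at this
      exact this
    rw [abs_mul, abs_of_nonneg ht] at h3
    linarith [le_abs_self γ₁]
  have hτy : τ * |y| ≤ |γs| := h2.trans (le_abs_self γs)
  have hY := abs_nonneg y
  set c := 1 + |γ₁| + |γs|
  have hc1 : t * |y| ≤ c := by simp only [c]; linarith [abs_nonneg γs]
  have hc2 : τ * |y| ≤ c := by simp only [c]; linarith [abs_nonneg γ₁]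
  have hc3 : (t + τ) * |y| ≤ c := by simp only [c]; linarith
  rw [← sq_abs y]
  constructor
  · rw [le_div_iff₀ hτ]
    calc t * |y| ^ 2 * τ = (t * |y|) * (τ * |y|) := by ring
      _ ≤ c * c := by gcongr
      _ = c ^ 2 := by ring
  · rw [div_pow, div_mul_div_comm, le_div_iff₀ (by positivity)]
    calc (t * |y| ^ 2) ^ 2 * (τ ^ 2 * (t + τ))
        = ((t * |y|) * ((t + τ) * |y|)) * ((τ * |y|) * (τ * |y|)) * t := by ring
      _ ≤ ((c * c) * (c * c)) * t := by gcongr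
      _ = (c ^ 2) ^ 2 * t := by ring

end Spectral

/-- The test at regularization level `τ` has error of the second kind at most `β` for all signals
of the source set whose norm exceeds bias plus noise level. -/
theorem measureReal_stat_reconOp_le {Ω H K : Type*} [MeasurableSpace Ω] {P : Measure Ω}
    [IsProbabilityMeasure P] [NormedAddCommGroup H] [InnerProductSpace ℝ H] [CompleteSpace H]
    [NormedAddCommGroup K] [InnerProductSpace ℝ K] [CompleteSpace K] {ξ : K → Ω → ℝ}
    {T : H →L[ℝ] K} {g : ℝ → ℝ → ℝ} {φ : ℝ → ℝ} {γ₁ γs γ τ x α β σ B : ℝ}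
    (hξ : IsGaussianWhiteNoise P ξ) (hT : IsHilbertSchmidt T)
    (hg : IsRegularization ‖normalOp T‖ g γ₁ γs) (hφ : IsIndexFunction ‖normalOp T‖ φ)
    (hq : HasQualification ‖normalOp T‖ g φ γ) (hτ : τ ∈ Ioc 0 ‖normalOp T‖) (hx : 1 ≤ x)
    (hα : α ∈ Ioo (0 : ℝ) 1) (hβ : β ∈ Ioo (0 : ℝ) 1) (hxα : Real.exp (-x) ≤ α)
    (hxβ : Real.exp (-x) ≤ β / 2) (hσ : 0 < σ)
    (hB : 12 * (1 + |γ₁| + |γs|) ^ 2 * (σ ^ 2 / τ) *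
      (√x * (√(effDim (normalOp T) τ) + √x)) ≤ B)
    {f : H} (hf : f ∈ sourceSet T φ) (hnorm : |γ| * φ τ + 3 * √(2 * B / β) < ‖f‖) :
    P.real {ω | stat P σ (reconOp T g τ) (obs T ξ σ f) ω ≤
      threshold P T ξ σ α (reconOp T g τ)} ≤ β := by
  obtain ⟨ι, b, s, hA⟩ := hT.exists_eigenbasis_normalOp
  have hs := eigenvalue_mem_Icc hA
  have hτ0 : 0 < τ := hτ.1
  set κ := (1 + |γ₁| + |γs|) ^ 2 with hκ
  have hκ0 : 0 < κ := by positivity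
  have hgb (i : ι) : |g τ (s i)| ≤ γs / τ := by
    rw [le_div_iff₀ hτ0, mul_comm]
    exact hg.mul_abs_le τ hτ _ (hs i)
  have hbd (i : ι) := mul_sq_bounds hτ0 (hs i).1 (hg.residual_le τ hτ _ (hs i))
    (hg.mul_abs_le τ hτ _ (hs i))
  rw [← hκ] at hbd
  set N := effDim (normalOp T) τ with hN
  have hN0 : 0 ≤ N := effDim_nonneg T τ
  have hsum : Summable fun i => s i * g τ (s i) ^ 2 := by
    refine Summable.of_nonneg_of_le (fun i => mul_nonneg (hs i).1 (sq_nonneg _)) (fun i => ?_)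
      ((summable_eigenvalues hA hT).mul_right ((γs / τ) ^ 2))
    refine mul_le_mul_of_nonneg_left ?_ (hs i).1
    rw [← sq_abs]
    exact pow_le_pow_left₀ (abs_nonneg _) (hgb i) 2
  have hv (S : Finset ι) : ∑ i ∈ S, (s i * g τ (s i) ^ 2) ^ 2 ≤ (κ / τ * √N) ^ 2 := by
    rw [mul_pow, Real.sq_sqrt hN0]
    calc ∑ i ∈ S, (s i * g τ (s i) ^ 2) ^ 2
        ≤ ∑ i ∈ S, (κ / τ) ^ 2 * (s i / (s i + τ)) := Finset.sum_le_sum fun i _ => (hbd i).2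
      _ = (κ / τ) ^ 2 * ∑ i ∈ S, s i / (s i + τ) := by rw [Finset.mul_sum]
      _ ≤ (κ / τ) ^ 2 * N := by
        refine mul_le_mul_of_nonneg_left ?_ (sq_nonneg _)
        exact sum_le_hasSum S (fun i _ => div_nonneg (hs i).1 (add_nonneg (hs i).1 hτ0.le))
          (hasSum_effDim hA hT hτ0)
  have hsx : 1 ≤ √x := Real.one_le_sqrt.2 hx
  have hB1 : σ ^ 2 * (κ / τ) ≤ B := by
    refine le_trans ?_ hB
    have h1 : 1 ≤ √x * (√N + √x) := by nlinarith [Real.sqrt_nonneg N]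
    have h2 : 0 ≤ κ * (σ ^ 2 / τ) := by positivity
    calc σ ^ 2 * (κ / τ) = κ * (σ ^ 2 / τ) := by ring
      _ ≤ 12 * κ * (σ ^ 2 / τ) * 1 := by linarith
      _ ≤ _ := by gcongr
  have hB2 : σ ^ 2 * (3 * √x * (κ / τ * √N + 4 * (κ / τ) * √x)) ≤ B := by
    refine le_trans ?_ hB
    have h2 : 0 ≤ κ * (σ ^ 2 / τ) * (√x * √N) := by positivity
    calc σ ^ 2 * (3 * √x * (κ / τ * √N + 4 * (κ / τ) * √x))
        = 3 * (κ * (σ ^ 2 / τ) * (√x * √N)) + 12 * κ * (σ ^ 2 / τ) * (√x * √x) := by ring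
      _ ≤ 12 * (κ * (σ ^ 2 / τ) * (√x * √N)) + 12 * κ * (σ ^ 2 / τ) * (√x * √x) := by linarith
      _ = _ := by ring
  have hB0 : 0 < B := lt_of_lt_of_le (by positivity) hB1
  have hβ0 := hβ.1
  set d := √(2 * B / β) with hd
  have hd0 : 0 < d := by positivity
  have hm : 3 * d < ‖reconOp T g τ (T f)‖ := by
    have h1 := norm_reconOp_sub_le hA hgb hφ hq hτ hf
    have h2 := norm_sub_norm_le f (reconOp T g τ (T f))
    rw [norm_sub_rev] at h2
    linarith
  refine measureReal_stat_le_threshold_le hξ (reconOp_adjoint_apply hA hgb) hsum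
    (by positivity) hv (by positivity) (fun i => (hbd i).1) (by linarith) hα hβ0 hxα hxβ hσ T
    (by linarith) ?_
  set m := ‖reconOp T g τ (T f)‖
  have hcross : σ * √(2 * (κ / τ) / β) ≤ d := by
    rw [hd]
    refine Real.le_sqrt_of_sq_le ?_
    rw [mul_pow, Real.sq_sqrt (by positivity), ← mul_div_assoc]
    gcongr ?_ / β
    linarith
  have hd2 : 2 * B ≤ d ^ 2 := by
    rw [hd, Real.sq_sqrt (by positivity), le_div_iff₀ hβ0]
    nlinarith [hβ.2]
  have hm0 : 0 < m := by linarith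
  have h3 := mul_le_mul_of_nonneg_left hcross hm0.le
  nlinarith

end SignalDetection

/-! ### The adaptive test -/

namespace SignalDetection

/-- A geometric grid starting at `a` and reaching below `τ` has a point within a factor `q` of
`τ`. -/
theorem exists_grid_point {a q τ : ℝ} {M : ℕ} (hq : q ∈ Ioo (0 : ℝ) 1) (hM : M ≠ 0)
    (hτ : τ ∈ Ioc 0 a) (hmin : q ^ (M - 1) * a ≤ τ) :
    ∃ j < M, q ^ j * a ≤ τ ∧ q * τ ≤ q ^ j * a := by
  classical
  have hex : ∃ j, q ^ j * a ≤ τ := ⟨_, hmin⟩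
  have hj : Nat.find hex < M := by
    have := Nat.find_min' hex hmin
    omega
  refine ⟨Nat.find hex, hj, Nat.find_spec hex, ?_⟩
  rcases Nat.eq_zero_or_eq_succ_pred (Nat.find hex) with h0 | h0
  · rw [h0, pow_zero, one_mul]
    exact (mul_le_of_le_one_left hτ.1.le hq.2.le).trans hτ.2
  · have h1 := Nat.find_min hex (m := (Nat.find hex).pred) (by omega)
    rw [h0, pow_succ', mul_assoc]
    exact mul_le_mul_of_nonneg_left (not_le.1 h1).le hq.1.le

section SeparationRadius

variable {Ω H K : Type*} [MeasurableSpace Ω] {P : Measure Ω} [NormedAddCommGroup H]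
  [InnerProductSpace ℝ H] [NormedAddCommGroup K] [InnerProductSpace ℝ K] {ξ : K → Ω → ℝ}
  {T : H →L[ℝ] K}

theorem separationRadius_nonneg (P : Measure Ω) (T : H →L[ℝ] K) (ξ : K → Ω → ℝ) (σ : ℝ)
    (Φ : (K → Ω → ℝ) → Ω → ℕ) (β : ℝ) (E : Set H) : 0 ≤ separationRadius P T ξ σ Φ β E :=
  Real.sInf_nonneg fun _ h => h.1

theorem separationRadius_le {σ β ρ : ℝ} {Φ : (K → Ω → ℝ) → Ω → ℕ} {E : Set H} (hρ : 0 ≤ ρ)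
    (h : ∀ f ∈ E, ρ < ‖f‖ → P.real {ω | Φ (obs T ξ σ f) ω = 0} ≤ β) :
    separationRadius P T ξ σ Φ β E ≤ ρ :=
  csInf_le ⟨0, fun _ h => h.1⟩ ⟨hρ, h⟩

end SeparationRadius

variable {Ω H K : Type*} [MeasurableSpace Ω] {P : Measure Ω}
  [IsProbabilityMeasure P] [NormedAddCommGroup H] [InnerProductSpace ℝ H] [CompleteSpace H]
  [NormedAddCommGroup K] [InnerProductSpace ℝ K] [CompleteSpace K] {ξ : K → Ω → ℝ}
  {T : H →L[ℝ] K} {g : ℝ → ℝ → ℝ} {φ : ℝ → ℝ}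

theorem measureReal_adaptiveTest_eq_zero_le {q σ α : ℝ} {M j : ℕ} (hj : j < M) (Y : K → Ω → ℝ) :
    P.real {ω | adaptiveTest P T ξ g q M σ α Y ω = 0} ≤
      P.real {ω | stat P σ (reconOp T g (q ^ j * ‖normalOp T‖)) Y ω ≤
        threshold P T ξ σ (α / M) (reconOp T g (q ^ j * ‖normalOp T‖))} := by
  refine measureReal_mono fun ω hω => ?_
  have h1 : test P T ξ σ (α / M) (reconOp T g (q ^ j * ‖normalOp T‖)) Y ω ≤
      adaptiveTest P T ξ g q M σ α Y ω :=
    Finset.le_sup (f := fun j => test P T ξ σ (α / M) (reconOp T g (q ^ j * ‖normalOp T‖)) Y ω)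
      (Finset.mem_range.2 hj)
  have h2 : adaptiveTest P T ξ g q M σ α Y ω = 0 := hω
  rw [h2, test] at h1
  rw [Set.mem_ofPred_eq]
  by_contra hcon
  rw [if_pos (not_le.1 hcon)] at h1
  omega

/-- The factor by which `φ(τ_*)²` has to be multiplied to dominate the noise level of the adaptive
test. The summands under the square roots account for the grid size, for `α` and for `β`, and keep
the deviation parameter `x` above `1`. -/
noncomputable def noiseConst (α β q γ₁ γs A : ℝ) : ℝ :=
  12 * (1 + |γ₁| + |γs|) ^ 2 / q * √(|A| + Real.log (1 / α) + Real.log (2 / β) + 1) *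
    (1 / √q + √(|A| + Real.log (1 / α) + Real.log (2 / β) + 1))

/-- The constant in the bound of the separation radius by `φ(τ_*)`. -/
noncomputable def radiusConst (α β q γ₁ γs γ A : ℝ) : ℝ :=
  |γ| + 3 * √(2 * noiseConst α β q γ₁ γs A / β)

/-- Some grid point lies within a factor `q` below `τ_*`; the test at this point alone has the
claimed power, although its level is only `α / M`. -/
theorem separationRadius_adaptiveTest_le {α β q γ₁ γs γ A σ τs L : ℝ} {M : ℕ}
    (hα : α ∈ Ioo (0 : ℝ) 1) (hβ : β ∈ Ioo (0 : ℝ) 1) (hq : q ∈ Ioo (0 : ℝ) 1)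
    (hξ : IsGaussianWhiteNoise P ξ) (hT : IsHilbertSchmidt T)
    (hg : IsRegularization ‖normalOp T‖ g γ₁ γs) (hφ : IsIndexFunction ‖normalOp T‖ φ)
    (hqual : HasQualification ‖normalOp T‖ g φ γ) (hσ : 0 < σ) (hL : 1 ≤ L) (hM : M ≠ 0)
    (hMA : Real.log M ≤ A * L) (hτ : τs ∈ Ioc 0 ‖normalOp T‖)
    (hmin : q ^ (M - 1) * ‖normalOp T‖ ≤ τs)
    (heq : φ τs ^ 2 = σ ^ 2 * √L * (√(effDim (normalOp T) τs) / τs))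
    (hN : L ≤ effDim (normalOp T) τs) :
    separationRadius P T ξ σ (adaptiveTest P T ξ g q M σ α) β (sourceSet T φ) ≤
      radiusConst α β q γ₁ γs γ A * φ τs := by
  obtain ⟨hq0, hq1⟩ := hq
  have ha : 0 < ‖normalOp T‖ := hτ.1.trans_le hτ.2
  have hτs0 := hτ.1
  have hφ0 (t : ℝ) (ht : t ∈ Icc 0 ‖normalOp T‖) : 0 ≤ φ t :=
    hφ.map_zero ▸ hφ.monotoneOn ⟨le_rfl, norm_nonneg _⟩ ht ht.1
  have hφs : 0 ≤ φ τs := hφ0 τs ⟨hτ.1.le, hτ.2⟩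
  obtain ⟨j, hjM, hj1, hj2⟩ := exists_grid_point ⟨hq0, hq1⟩ hM hτ hmin
  set τ := q ^ j * ‖normalOp T‖ with hτdef
  have hτ0 : 0 < τ := by positivity
  have hτmem : τ ∈ Ioc 0 ‖normalOp T‖ := ⟨hτ0, hj1.trans hτ.2⟩
  set N := effDim (normalOp T) τ with hNdef
  set Ns := effDim (normalOp T) τs with hNsdef
  have hNs0 : 0 < Ns := by linarith
  have hNle : N ≤ Ns / q := by
    have h1 : τ * N ≤ τs * Ns := mul_effDim_mono hT hτ0 hj1
    have hN0 : 0 ≤ N := effDim_nonneg T τ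
    rw [le_div_iff₀ hq0]
    have h2 : τs * (N * q) ≤ τs * Ns := by nlinarith
    exact le_of_mul_le_mul_left h2 hτs0
  have hα0 := hα.1
  have hβ0 := hβ.1
  have hlα : 0 ≤ Real.log (1 / α) := Real.log_nonneg (by
    rw [le_div_iff₀ hα0]; linarith [hα.2])
  have hlβ : 0 ≤ Real.log (2 / β) := Real.log_nonneg (by
    rw [le_div_iff₀ hβ0]; linarith [hβ.2])
  set B := |A| + Real.log (1 / α) + Real.log (2 / β) + 1 with hBdef
  have hB1 : 1 ≤ B := by linarith [abs_nonneg A]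
  have hL0 : 0 < L := by linarith
  have hM0 : (0 : ℝ) < M := by positivity
  have hM1 : (1 : ℝ) ≤ M := by exact_mod_cast Nat.one_le_iff_ne_zero.2 hM
  have hαM : α / M ∈ Ioo (0 : ℝ) 1 := ⟨by positivity, by
    rw [div_lt_one hM0]; linarith [hα.2]⟩
  have hBL : |A| * L + Real.log (1 / α) + Real.log (2 / β) ≤ B * L := by
    rw [hBdef]; nlinarith
  have hxα : Real.exp (-(B * L)) ≤ α / M := by
    rw [← Real.le_log_iff_exp_le hαM.1, Real.log_div hα0.ne' hM0.ne']
    rw [one_div, Real.log_inv] at hBL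
    nlinarith [le_abs_self A]
  have hxβ : Real.exp (-(B * L)) ≤ β / 2 := by
    rw [← Real.le_log_iff_exp_le (by positivity), ← inv_div, Real.log_inv]
    have : 0 ≤ |A| * L := by positivity
    linarith
  have hnoise : 12 * (1 + |γ₁| + |γs|) ^ 2 * (σ ^ 2 / τ) *
      (√(B * L) * (√N + √(B * L))) ≤ noiseConst α β q γ₁ γs A * φ τs ^ 2 := by
    have hs1 : √(B * L) = √B * √L := Real.sqrt_mul (by linarith) L
    have hs2 : √(B * L) ≤ √B * √Ns := by
      rw [hs1]; gcongr
    have hs3 : √N ≤ 1 / √q * √Ns := by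
      rw [one_div_mul_eq_div, ← Real.sqrt_div hNs0.le]
      exact Real.sqrt_le_sqrt hNle
    have hs4 : σ ^ 2 / τ ≤ σ ^ 2 / (q * τs) := by gcongr
    rw [heq]
    calc 12 * (1 + |γ₁| + |γs|) ^ 2 * (σ ^ 2 / τ) * (√(B * L) * (√N + √(B * L)))
        ≤ 12 * (1 + |γ₁| + |γs|) ^ 2 * (σ ^ 2 / (q * τs)) *
          (√B * √L * (1 / √q * √Ns + √B * √Ns)) := by
          gcongr
          exact hs1.le
      _ = noiseConst α β q γ₁ γs A * (σ ^ 2 * √L * (√Ns / τs)) := by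
          rw [noiseConst, ← hBdef]
          have : √q ≠ 0 := by positivity
          field_simp
  have hD0 : 0 ≤ radiusConst α β q γ₁ γs γ A := by unfold radiusConst; positivity
  refine separationRadius_le (by positivity) fun f hf hfn => ?_
  refine (measureReal_adaptiveTest_eq_zero_le hjM _).trans ?_
  refine measureReal_stat_reconOp_le hξ hT hg hφ hqual hτmem (by nlinarith) hαM hβ hxα hxβ hσ
    hnoise hf ?_
  refine lt_of_le_of_lt ?_ hfn
  have hsqrt : √(2 * (noiseConst α β q γ₁ γs A * φ τs ^ 2) / β) =
      √(2 * noiseConst α β q γ₁ γs A / β) * φ τs := by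
    rw [← Real.sqrt_sq hφs, ← Real.sqrt_mul' _ (sq_nonneg _), Real.sqrt_sq hφs]
    congr 1
    ring
  have hmono : φ τ ≤ φ τs :=
    hφ.monotoneOn ⟨hτ0.le, hτmem.2⟩ ⟨hτs0.le, hτ.2⟩ hj1
  rw [hsqrt, radiusConst, add_mul, ← mul_assoc]
  gcongr

/-- At the solution `τ_*` of the balancing equation, neither of the two terms can be improved, as
one decreases and the other increases with `τ`. -/
theorem sq_le_iInf {τs c : ℝ} (hT : IsHilbertSchmidt T) (hφ : IsIndexFunction ‖normalOp T‖ φ)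
    (hτ : τs ∈ Ioc 0 ‖normalOp T‖) (hc : 0 ≤ c)
    (heq : φ τs ^ 2 = c * (√(effDim (normalOp T) τs) / τs)) :
    φ τs ^ 2 ≤ ⨅ τ : Ioc (0 : ℝ) ‖normalOp T‖,
      (c * (√(effDim (normalOp T) τ) / τ) + φ τ ^ 2) := by
  have : Nonempty (Ioc (0 : ℝ) ‖normalOp T‖) := ⟨⟨τs, hτ⟩⟩
  refine le_ciInf fun τ => ?_
  have hτ0 : 0 < (τ : ℝ) := τ.2.1
  rcases le_total τs τ with h | h
  · have h0 : 0 ≤ φ τs := hφ.map_zero ▸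
      hφ.monotoneOn ⟨le_rfl, norm_nonneg _⟩ ⟨hτ.1.le, hτ.2⟩ hτ.1.le
    have h1 : φ τs ≤ φ τ := hφ.monotoneOn ⟨hτ.1.le, hτ.2⟩ ⟨τ.2.1.le, τ.2.2⟩ h
    have h2 : φ τs ^ 2 ≤ φ τ ^ 2 := pow_le_pow_left₀ h0 h1 2
    have h3 : 0 ≤ c * (√(effDim (normalOp T) τ) / τ) := by positivity
    linarith
  · have h1 := mul_le_mul_of_nonneg_left (sqrt_effDim_div_anti hT hτ0 h) hc
    have h2 := sq_nonneg (φ τ)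
    linarith

/-! ### Small noise levels -/

theorem tendsto_one_div_sq : Tendsto (fun σ : ℝ => 1 / σ ^ 2) (𝓝[>] 0) atTop := by
  have h : Tendsto (fun σ : ℝ => σ⁻¹ ^ 2) (𝓝[>] 0) atTop :=
    (tendsto_pow_atTop two_ne_zero).comp tendsto_inv_nhdsGT_zero
  simpa [inv_pow] using h

theorem tendsto_log_log :
    Tendsto (fun σ : ℝ => Real.log (Real.log (1 / σ ^ 2))) (𝓝[>] 0) atTop :=
  Real.tendsto_log_atTop.comp (Real.tendsto_log_atTop.comp tendsto_one_div_sq)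

theorem logLog_eventually_eq {q : ℝ} (hq : q ∈ Ioo (0 : ℝ) 1) :
    ∀ᶠ σ in 𝓝[>] (0 : ℝ), logLog q σ =
      Real.log (Real.log (1 / σ ^ 2)) - Real.log (Real.log (1 / q)) := by
  have hlq : 0 < Real.log (1 / q) := Real.log_pos (by
    rw [lt_div_iff₀ hq.1]; linarith [hq.2])
  filter_upwards [(Real.tendsto_log_atTop.comp tendsto_one_div_sq).eventually_gt_atTop 0]
    with σ (hσ : 0 < Real.log (1 / σ ^ 2))
  rw [logLog, Real.logb, Real.log_div hσ.ne' hlq.ne']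

theorem tendsto_logLog {q : ℝ} (hq : q ∈ Ioo (0 : ℝ) 1) :
    Tendsto (logLog q) (𝓝[>] 0) atTop := by
  refine Tendsto.congr' (EventuallyEq.symm (logLog_eventually_eq hq)) ?_
  exact tendsto_atTop_add_const_right _ _ tendsto_log_log

/-- A grid of logarithmic size reaches down to `τ_min ≤ σ² / q`. -/
theorem pow_mul_le_of_logb_le {q a σ : ℝ} {M : ℕ} (hq : q ∈ Ioo (0 : ℝ) 1) (ha : 0 < a)
    (hσ : 0 < σ)
    (hM : Real.logb (1 / q) (√2 * a) + Real.logb (1 / q) (1 / σ ^ 2) ≤ (M : ℝ)) :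
    q ^ M * a ≤ σ ^ 2 := by
  have hq1 : 1 < 1 / q := by rw [lt_div_iff₀ hq.1]; linarith [hq.2]
  have hq0 := hq.1
  rw [← Real.logb_mul (by positivity) (by positivity), Real.logb_le_iff_le_rpow hq1
    (by positivity), Real.rpow_natCast, one_div_pow, mul_one_div, div_le_div_iff₀ (by positivity)
    (by positivity), one_mul] at hM
  have h2 : (1 : ℝ) ≤ √2 := Real.one_le_sqrt.2 one_le_two
  have h3 : 0 ≤ a * q ^ M := by positivity
  nlinarith

end SignalDetection

namespace SignalDetection

theorem noiseConst_pos {α β q : ℝ} (γ₁ γs A : ℝ) (hα : α ∈ Ioo (0 : ℝ) 1)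
    (hβ : β ∈ Ioo (0 : ℝ) 1) (hq : q ∈ Ioo (0 : ℝ) 1) : 0 < noiseConst α β q γ₁ γs A := by
  have hα0 := hα.1
  have hβ0 := hβ.1
  have hq0 := hq.1
  have hlα : 0 ≤ Real.log (1 / α) := Real.log_nonneg (by
    rw [le_div_iff₀ hα0]; linarith [hα.2])
  have hlβ : 0 ≤ Real.log (2 / β) := Real.log_nonneg (by
    rw [le_div_iff₀ hβ0]; linarith [hβ.2])
  unfold noiseConst
  positivity

theorem radiusConst_pos {α β q : ℝ} (γ₁ γs γ A : ℝ) (hα : α ∈ Ioo (0 : ℝ) 1)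
    (hβ : β ∈ Ioo (0 : ℝ) 1) (hq : q ∈ Ioo (0 : ℝ) 1) : 0 < radiusConst α β q γ₁ γs γ A := by
  have h1 := noiseConst_pos γ₁ γs A hα hβ hq
  have hβ0 := hβ.1
  unfold radiusConst
  positivity

end SignalDetection

theorem mainTheorem4 (α β q γ₁ γs γ A : ℝ)
    (hα : α ∈ Ioo (0 : ℝ) 1) (hβ : β ∈ Ioo (0 : ℝ) 1) (hq : q ∈ Ioo (0 : ℝ) 1) :
    ∃ C > (0 : ℝ), ∃ D > (0 : ℝ),
      ∀ (H : Type u) [NormedAddCommGroup H] [InnerProductSpace ℝ H] [CompleteSpace H]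
        (K : Type v) [NormedAddCommGroup K] [InnerProductSpace ℝ K] [CompleteSpace K]
        (Ω : Type w) [MeasurableSpace Ω] (P : Measure Ω) [IsProbabilityMeasure P]
        (ξ : K → Ω → ℝ) (T : H →L[ℝ] K) (g : ℝ → ℝ → ℝ) (φ : ℝ → ℝ)
        (M : ℝ → ℕ) (τs : ℝ → ℝ),
        SignalDetection.IsGaussianWhiteNoise P ξ →
        SignalDetection.IsHilbertSchmidt T →
        SignalDetection.IsRegularization ‖SignalDetection.normalOp T‖ g γ₁ γs →
        SignalDetection.IsIndexFunction ‖SignalDetection.normalOp T‖ φ →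
        SignalDetection.HasQualification ‖SignalDetection.normalOp T‖ g φ γ →
        -- the size `M = M(σ)` of the grid
        (∀ᶠ σ in 𝓝[>] (0 : ℝ),
          Real.logb (1 / q) (√2 * ‖SignalDetection.normalOp T‖) + Real.logb (1 / q) (1 / σ ^ 2)
              ≤ (M σ : ℝ) ∧
            Real.log (M σ) ≤ A * SignalDetection.logLog q σ) →
        -- `φ(τ_min) ≤ 1`, where `τ_min` is the smallest point of the grid
        (∀ᶠ σ in 𝓝[>] (0 : ℝ), φ (q ^ (M σ - 1) * ‖SignalDetection.normalOp T‖) ≤ 1) →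
        -- the equation for `τ_*`
        (∀ᶠ σ in 𝓝[>] (0 : ℝ),
          τs σ ∈ Ioc 0 ‖SignalDetection.normalOp T‖ ∧
            φ (τs σ) ^ 2 = σ ^ 2 * √(SignalDetection.logLog q σ) *
              (√(SignalDetection.effDim (SignalDetection.normalOp T) (τs σ)) / τs σ)) →
        Tendsto (fun σ : ℝ => Real.log (Real.log (1 / σ ^ 2)) /
            SignalDetection.effDim (SignalDetection.normalOp T) (τs σ)) (𝓝[>] 0) (𝓝 0) →
        (∀ᶠ σ in 𝓝[>] (0 : ℝ),
          SignalDetection.separationRadius P T ξ σ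
              (SignalDetection.adaptiveTest P T ξ g q (M σ) σ α) β
              (SignalDetection.sourceSet T φ) ^ 2 ≤
            C * ⨅ τ : Ioc (0 : ℝ) ‖SignalDetection.normalOp T‖,
              (σ ^ 2 * √(SignalDetection.logLog q σ) *
                (√(SignalDetection.effDim (SignalDetection.normalOp T) τ) / τ) +
                  φ τ ^ 2)) ∧
          Tendsto τs (𝓝[>] 0) (𝓝[>] 0) ∧
          ∀ᶠ σ in 𝓝[>] (0 : ℝ),
            SignalDetection.separationRadius P T ξ σ
              (SignalDetection.adaptiveTest P T ξ g q (M σ) σ α) β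
              (SignalDetection.sourceSet T φ) ≤ D * φ (τs σ) := by
  have hDpos := SignalDetection.radiusConst_pos γ₁ γs γ A hα hβ hq
  refine ⟨SignalDetection.radiusConst α β q γ₁ γs γ A ^ 2, by positivity,
    SignalDetection.radiusConst α β q γ₁ γs γ A, hDpos, ?_⟩
  intro H _ _ _ K _ _ _ Ω _ P _ ξ T g φ M τs hξ hT hg hφ hqual hM hφmin hτs hlim
  have ha : 0 < ‖SignalDetection.normalOp T‖ := by
    obtain ⟨σ, hσ, _⟩ := hτs.exists
    exact hσ.1.trans_le hσ.2
  have hLtop := SignalDetection.tendsto_logLog hq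
  -- `log log_{1/q} (1/σ²)` and `log log (1/σ²)` differ by a constant only
  have hLN : ∀ᶠ σ in 𝓝[>] (0 : ℝ), SignalDetection.logLog q σ ≤
      SignalDetection.effDim (SignalDetection.normalOp T) (τs σ) := by
    filter_upwards [SignalDetection.logLog_eventually_eq hq, hτs,
      hlim.eventually (gt_mem_nhds one_half_pos), SignalDetection.tendsto_log_log.eventually_ge_atTop
        (-Real.log (Real.log (1 / q)))] with σ h1 h2 h3 h4
    have hN := SignalDetection.effDim_pos hT ha h2.1.1
    rw [div_lt_iff₀ hN] at h3
    linarith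
  have hgrid : ∀ᶠ σ in 𝓝[>] (0 : ℝ), M σ ≠ 0 ∧
      q ^ (M σ - 1) * ‖SignalDetection.normalOp T‖ ≤ τs σ := by
    have hσa : ∀ᶠ σ in 𝓝[>] (0 : ℝ), σ ^ 2 < ‖SignalDetection.normalOp T‖ := by
      have h1 : Tendsto (fun σ : ℝ => σ ^ 2) (𝓝[>] 0) (𝓝 0) := by
        have h2 : Tendsto (fun σ : ℝ => σ ^ 2) (𝓝 0) (𝓝 (0 ^ 2)) :=
          (continuous_pow 2).tendsto 0
        rw [zero_pow two_ne_zero] at h2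
        exact h2.mono_left nhdsWithin_le_nhds
      exact h1.eventually (gt_mem_nhds ha)
    filter_upwards [hM, hφmin, hτs, hLN, self_mem_nhdsWithin, hσa,
      hLtop.eventually_gt_atTop (1 / q)] with σ h1 h2 h3 h4 (hσ : 0 < σ) h5 h6
    have hpow := SignalDetection.pow_mul_le_of_logb_le hq ha hσ h1.1
    have hM0 : M σ ≠ 0 := fun h0 => by
      rw [h0, pow_zero, one_mul] at hpow
      linarith
    refine ⟨hM0, ?_⟩
    -- below the grid, the right hand side of the equation for `τ_*` would exceed `1`
    by_contra! hlt
    have hq0 := hq.1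
    set L := SignalDetection.logLog q σ
    set N := SignalDetection.effDim (SignalDetection.normalOp T) (τs σ)
    have hτ0 := h3.1.1
    have hL0 : 0 < L := lt_trans (by positivity) h6
    set τm := q ^ (M σ - 1) * ‖SignalDetection.normalOp T‖
    have hτm : τm ≤ ‖SignalDetection.normalOp T‖ :=
      mul_le_of_le_one_left ha.le (pow_le_one₀ hq0.le hq.2.le)
    have hφ0 : 0 ≤ φ (τs σ) :=
      hφ.map_zero ▸ hφ.monotoneOn ⟨le_rfl, ha.le⟩ ⟨hτ0.le, h3.1.2⟩ hτ0.le
    have hφ1 : φ (τs σ) ≤ 1 :=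
      (hφ.monotoneOn ⟨hτ0.le, h3.1.2⟩ ⟨(hτ0.trans hlt).le, hτm⟩ hlt.le).trans h2
    have hle : φ (τs σ) ^ 2 ≤ 1 := pow_le_one₀ hφ0 hφ1
    have hqτ : q * τm ≤ σ ^ 2 := by
      rw [← mul_assoc, ← pow_succ', Nat.sub_add_cancel (Nat.one_le_iff_ne_zero.2 hM0)]
      exact hpow
    have hsq : L ≤ √L * √N := by
      calc L = √L * √L := (Real.mul_self_sqrt hL0.le).symm
        _ ≤ √L * √N := by gcongr
    rw [h3.2, mul_div_assoc', div_le_one hτ0] at hle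
    have h7 : σ ^ 2 * L ≤ τs σ := by nlinarith [sq_nonneg σ]
    have h8 : σ ^ 2 * (1 / q) < σ ^ 2 * L := mul_lt_mul_of_pos_left h6 (by positivity)
    rw [mul_one_div, div_lt_iff₀ hq0] at h8
    nlinarith
  have hrad : ∀ᶠ σ in 𝓝[>] (0 : ℝ), SignalDetection.separationRadius P T ξ σ
      (SignalDetection.adaptiveTest P T ξ g q (M σ) σ α) β (SignalDetection.sourceSet T φ) ≤
        SignalDetection.radiusConst α β q γ₁ γs γ A * φ (τs σ) := by
    filter_upwards [hM, hτs, hLN, hgrid, self_mem_nhdsWithin, hLtop.eventually_ge_atTop 1]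
      with σ h1 h2 h3 h4 hσ h5
    exact SignalDetection.separationRadius_adaptiveTest_le hα hβ hq hξ hT hg hφ hqual hσ h5 h4.1
      h1.2 h2.1 h4.2 h2.2 h3
  refine ⟨?_, ?_, hrad⟩
  · filter_upwards [hrad, hτs] with σ h1 h2
    refine (pow_le_pow_left₀ (SignalDetection.separationRadius_nonneg _ _ _ _ _ _ _) h1 2).trans ?_
    rw [mul_pow]
    exact mul_le_mul_of_nonneg_left
      (SignalDetection.sq_le_iInf hT hφ h2.1 (by positivity) h2.2) (sq_nonneg _)
  · refine tendsto_nhdsWithin_iff.2 ⟨?_, hτs.mono fun σ h => h.1.1⟩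
    obtain ⟨S, hS⟩ := SignalDetection.exists_mul_effDim_le hT
    refine tendsto_of_tendsto_of_tendsto_of_le_of_le' tendsto_const_nhds
      (hLtop.const_div_atTop S) (hτs.mono fun σ h => h.1.1.le) ?_
    filter_upwards [hτs, hLN, hLtop.eventually_gt_atTop 0] with σ h1 h2 h3
    rw [le_div_iff₀ h3]
    exact (mul_le_mul_of_nonneg_left h2 h1.1.1.le).trans (hS _ h1.1.1)
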